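/- **Setting (transition algebra, TA).** A signature $\Sigma=(S,F,L)$ consists of a set $S$ of sorts, a set $F$ of function symbols $\sigma:w\to s$ ($w\in S^*$, $s\in S$; constants are the symbols with $w$ empty) and a set $L$ of transition labels. A $\Sigma$-model $\mathfrak A$ has a (possibly empty) carrier set $\mathfrak A_s$ for each $s\in S$, a function $\sigma^{\mathfrak A}$ for each $\sigma\in F$, and for each $\varrho\in L$ and $s\in S$ a binary relation $\varrho^{\mathfrak A}_s\subseteq\mathfrak A_s\times\mathfrak A_s$. Actions are given by $\mathfrak a::=\varrho\mid\mathfrak a;\mathfrak a\mid\mathfrak a\cup\mathfrak a\mid\mathfrak a^*$ and are interpreted by composition, union and reflexive-transitive closure of relations. Sentences over $\Sigma$ are given by $\phi::=t=t'\mid\mathfrak a(t,t')\mid\neg\phi\mid\bigvee\Phi\mid\exists X\,\phi'$, where $t,t'$ are ground $\Sigma$-terms of the same sort, $\Phi$ is a finite set of $\Sigma$-sentences, $X$ is a finite block of sorted variables and $\phi'$ is a sentence over $\Sigma[X]$; here $\Sigma[C]$ denotes $\Sigma$ with the elements of an $S$-sorted set $C$ added as new constants. Satisfaction is the usual one; $\mathfrak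 A\models\exists X\,\phi'$ iff $\phi'$ holds in some expansion of $\mathfrak A$ to $\Sigma[X]$. A *fragment* $\mathcal L$ is given by a class of signatures that is closed under $\Sigma\mapsto\Sigma[C]$ and by discarding some (possibly none) of the sentence and action operators from the grammars; $\mathsf{Sen}(\Sigma)$ is the set of the sentences of $\mathcal L$ over $\Sigma$. The *power* of $\Sigma$ is $\mathsf{card}(\mathsf{Sen}(\Sigma))$. The fragment is *compact* if, for each signature $\Sigma$ of $\mathcal L$, a set $\Phi\subseteq\mathsf{Sen}(\Sigma)$ has a model iff every finite subset of $\Phi$ has a model. Let $\Sigma$ be a signature of $\mathcal L$ of infinite power $\alpha$. A *type* for $\Sigma$ is a set $T\subseteq\mathsf{Sen}(\Sigma[X])$, where $X$ is a (possibly infinite) set of sorted variables with $\alpha^{\mathsf{card}(X)}\le\alpha$. A $\Sigma$-model *realizes* $T$ if some expansion of it to $\Sigma[X]$ satisfies $T$, and *omits* $T$ otherwise. A set $\Phi\subseteq\mathsf{Sen}(\Sigma)$ *isolates* $T$ if there are an $S$-sorted set $D$ of new constants with $\mathsf{card}(D)<\alpha$, a set $\Gamma\subseteq\mathsf{Sen}(\Sigma[D])$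 with $\mathsf{card}(\Gamma)<\alpha$ such that $\Phi\cup\Gamma$ has a $\Sigma[D]$-model, and a substitution $\theta$ of ground $\Sigma[D]$-terms for the variables in $X$, such that every $\Sigma[D]$-model of $\Phi\cup\Gamma$ satisfies $\theta(T)$. $\Phi$ *locally omits* $T$ if it does not isolate $T$. For an infinite cardinal $\alpha$, $\mathcal L$ has the *$\alpha$-omitting types property* ($\alpha$-OTP) if for every signature $\Sigma$ of $\mathcal L$ of power $\alpha$, every satisfiable $\Phi\subseteq\mathsf{Sen}(\Sigma)$ and every family of at most $\alpha$ types for $\Sigma$, each of which is locally omitted by $\Phi$, there is a $\Sigma$-model of $\Phi$ which omits all types of the family. **Theorem (Omitting Types Theorem).** Let $\mathcal L$ be a fragment of TA whose sentences are closed under negation (that is, $\neg$ is not among the discarded operators), and let $\alpha$ be an infinite cardinal. If $\alpha>\omega$, assume that $\mathcal L$ is compact. Then $\mathcal L$ has $\alpha$-OTP. In particular, every fragment of TA that is closed under negation has $\omega$-OTP. -/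

import Mathlib

universe u

namespace TA

/-- A (ranked) family of function symbols over a set `S` of sorts: `F w s` is the set of the
function symbols `σ : w → s`.  The members of `F [] s` are the constants of sort `s`. -/
abbrev Ops (S : Type u) : Type (u + 1) := List S → S → Type u

/-- A signature `(S, F, L)`: sorts, function symbols and transition labels. -/
structure Signature : Type (u + 1) where
  Srt : Type u
  Op : Ops Srt
  Lab : Type u

section Language

variable {S L : Type u}

/-- The function symbols of `F` together with the elements of the `S`-sorted set `C`, which are
added as new constants. -/
inductive Ext (F : Ops S) (C : S → Type u) : List S → S → Type u
  | old {w : List S} {s : S} (f : F w s) : Ext F C w s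
  | new {s : S} (c : C s) : Ext F C [] s

/-- Ground terms over `F`. -/
inductive Term (F : Ops S) : S → Type u
  | app {w : List S} {s : S} (f : F w s) (ts : ∀ i : Fin w.length, Term F (w.get i)) : Term F s

/-- Actions over the set `L` of labels. -/
inductive Act (L : Type u) : Type u
  | lab (l : L) : Act L
  | comp (a b : Act L) : Act L
  | union (a b : Act L) : Act L
  | star (a : Act L) : Act L

/-- A finite block of variables: a finite set of pairs (variable name, sort) in which a variable
name does not occur with two different sorts. -/
structure Block (S : Type u) : Type u where
  vars : Finset (ℕ × S)
  coherent : ∀ x ∈ vars, ∀ y ∈ vars, x.2 ≠ y.2 → x.1 ≠ y.1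

/-- The `S`-sorted set of the variables in a block. -/
def Block.fam (X : Block S) (s : S) : Type u := ULift.{u} {i : ℕ // (i, s) ∈ X.vars}

/-- Sentences over the sorts `S`, the labels `L` and the function symbols `F`.  The disjunction
takes a finite family; the body of a quantified sentence is a sentence over the signature
extended with the quantified variables as new constants. -/
inductive Sen (S L : Type u) : Ops S → Type (u + 1)
  | eq {F : Ops S} {s : S} (t t' : Term F s) : Sen S L F
  | trans {F : Ops S} {s : S} (a : Act L) (t t' : Term F s) : Sen S L F
  | neg {F : Ops S} (φ : Sen S L F) : Sen S L F
  | disj {F : Ops S} (n : ℕ) (φ : Fin n → Sen S L F) : Sen S L F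
  | ex {F : Ops S} (X : Block S) (φ : Sen S L (Ext F X.fam)) : Sen S L F

/-- Models (transition algebras).  Carrier sets may be empty. -/
structure Model (S L : Type u) (F : Ops S) : Type (u + 1) where
  carrier : S → Type u
  op : ∀ {w : List S} {s : S}, F w s → (∀ i : Fin w.length, carrier (w.get i)) → carrier s
  rel : L → ∀ s : S, carrier s → carrier s → Prop

namespace Model

variable {F : Ops S}

/-- The value of a ground term. -/
def eval (A : Model S L F) : {s : S} → Term F s → A.carrier s
  | _, .app f ts => A.op f fun i => A.eval (ts i)

/-- The interpretation of an action. -/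
def act (A : Model S L F) : Act L → ∀ s : S, A.carrier s → A.carrier s → Prop
  | .lab l, s => A.rel l s
  | .comp a b, s => Relation.Comp (A.act a s) (A.act b s)
  | .union a b, s => fun x y => A.act a s x y ∨ A.act b s x y
  | .star a, s => Relation.ReflTransGen (A.act a s)

/-- The expansion of a model along the inclusion of `F` into `Ext F C` that is given by an
interpretation `v` of the new constants. -/
def expand (A : Model S L F) {C : S → Type u} (v : ∀ s, C s → A.carrier s) :
    Model S L (Ext F C) where
  carrier := A.carrier
  op := fun f => match f with
    | .old f => A.op f
    | .new c => fun _ => v _ c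
  rel := A.rel

end Model

/-- Satisfaction of a sentence in a model. -/
def Sat : {F : Ops S} → Model S L F → Sen S L F → Prop
  | _, A, .eq t t' => A.eval t = A.eval t'
  | _, A, .trans a t t' => A.act a _ (A.eval t) (A.eval t')
  | _, A, .neg φ => ¬ Sat A φ
  | _, A, .disj n φ => ∃ i : Fin n, Sat A (φ i)
  | _, A, .ex X φ => ∃ v : ∀ s, X.fam s → A.carrier s, Sat (A.expand v) φ

/-- `A` is a model of every sentence in `Φ`. -/
def Models {F : Ops S} (A : Model S L F) (Φ : Set (Sen S L F)) : Prop := ∀ φ ∈ Φ, Sat A φ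

/-- `Φ` has a model. -/
def Satisfiable {F : Ops S} (Φ : Set (Sen S L F)) : Prop := ∃ A : Model S L F, Models A Φ

/-- Every model of `Φ` is a model of `Ψ`. -/
def Entails {F : Ops S} (Φ Ψ : Set (Sen S L F)) : Prop :=
  ∀ A : Model S L F, Models A Φ → Models A Ψ

/-- What a translation may assign to a function symbol: a function symbol of the same arity and
sort, or, to a constant, a ground term of the same sort. -/
inductive Img (F : Ops S) : List S → S → Type u
  | op {w : List S} {s : S} (f : F w s) : Img F w s
  | tm {s : S} (t : Term F s) : Img F [] s

/-- The term which results from applying an image of a function symbol to arguments. -/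
def Img.app {F : Ops S} : {w : List S} → {s : S} → Img F w s →
    (∀ i : Fin w.length, Term F (w.get i)) → Term F s
  | _, _, .op f, ts => .app f ts
  | _, _, .tm t, _ => t

/-- Translations from `F` to `F'` (with the same sorts); inclusions of signatures and
substitutions of terms for constants are of this form. -/
abbrev Transl (F F' : Ops S) : Type u := ∀ ⦃w : List S⦄ ⦃s : S⦄, F w s → Img F' w s

/-- Translation of ground terms. -/
def Term.map {F F' : Ops S} (θ : Transl F F') : {s : S} → Term F s → Term F' s
  | _, .app f ts => (θ f).app fun i => (ts i).map θ

/-- The inclusion of `F` into its extension with new constants. -/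
def incl (F : Ops S) (C : S → Type u) : Transl F (Ext F C) := fun _ _ f => .op (.old f)

/-- The inclusion of images that is induced by the inclusion of `F` into `Ext F C`. -/
def Img.weaken {F : Ops S} (C : S → Type u) : {w : List S} → {s : S} →
    Img F w s → Img (Ext F C) w s
  | _, _, .op f => .op (.old f)
  | _, _, .tm t => .tm (t.map (incl F C))

/-- The extension of a translation that leaves the new constants fixed. -/
def Transl.lift {F F' : Ops S} (θ : Transl F F') (C : S → Type u) :
    Transl (Ext F C) (Ext F' C) := fun _ _ f =>
  match f with
  | .old f => (θ f).weaken C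
  | .new c => .op (.new c)

/-- Translation of sentences. -/
def Sen.map : {F F' : Ops S} → Transl F F' → Sen S L F → Sen S L F'
  | _, _, θ, .eq t t' => .eq (t.map θ) (t'.map θ)
  | _, _, θ, .trans a t t' => .trans a (t.map θ) (t'.map θ)
  | _, _, θ, .neg φ => .neg (φ.map θ)
  | _, _, θ, .disj n φ => .disj n fun i => (φ i).map θ
  | _, _, θ, .ex X φ => .ex X (φ.map (θ.lift X.fam))

/-- A substitution `θ : C → D` assigns to each constant in `C` a term over `F` and the constants
in `D`; this is the induced translation, which preserves `F`. -/
def substitution {F : Ops S} {C D : S → Type u} (θ : ∀ s, C s → Term (Ext F D) s) :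
    Transl (Ext F C) (Ext F D) := fun _ _ f =>
  match f with
  | .old f => .op (.old f)
  | .new c => .tm (θ _ c)

/-- `A` realizes `T` if some expansion of `A` to the signature with the variables `X` as new
constants satisfies `T`. -/
def Realizes {F : Ops S} (A : Model S L F) {X : S → Type u} (T : Set (Sen S L (Ext F X))) :
    Prop :=
  ∃ v : ∀ s, X s → A.carrier s, Models (A.expand v) T

end Language

/-- The extension of a signature with an `S`-sorted set of new constants. -/
def Signature.extend (Sg : Signature.{u}) (C : Sg.Srt → Type u) : Signature.{u} where
  Srt := Sg.Srt
  Op := Ext Sg.Op C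
  Lab := Sg.Lab

/-- All sentences over a signature. -/
abbrev Signature.Sentence (Sg : Signature.{u}) : Type (u + 1) := Sen Sg.Srt Sg.Lab Sg.Op

/-- A fragment of the logic: a class of signatures that is closed under extensions with new
constants, and a choice of the operators that are kept in the grammar of sentences and of
actions. -/
structure Fragment : Type (u + 1) where
  sig : Set Signature.{u}
  extend_mem : ∀ Sg ∈ sig, ∀ C : Sg.Srt → Type u, Sg.extend C ∈ sig
  hasEq : Prop
  hasTrans : Prop
  hasNeg : Prop
  hasDisj : Prop
  hasEx : Prop
  hasComp : Prop
  hasUnion : Prop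
  hasStar : Prop

namespace Fragment

/-- The actions of the fragment. -/
def IsAct (𝓛 : Fragment.{u}) {L : Type u} : Act L → Prop
  | .lab _ => True
  | .comp a b => 𝓛.hasComp ∧ 𝓛.IsAct a ∧ 𝓛.IsAct b
  | .union a b => 𝓛.hasUnion ∧ 𝓛.IsAct a ∧ 𝓛.IsAct b
  | .star a => 𝓛.hasStar ∧ 𝓛.IsAct a

/-- The sentences that are built with the operators of the fragment. -/
def IsSen (𝓛 : Fragment.{u}) {S L : Type u} : {F : Ops S} → Sen S L F → Prop
  | _, .eq _ _ => 𝓛.hasEq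
  | _, .trans a _ _ => 𝓛.hasTrans ∧ 𝓛.IsAct a
  | _, .neg φ => 𝓛.hasNeg ∧ 𝓛.IsSen φ
  | _, .disj _ φ => 𝓛.hasDisj ∧ ∀ i, 𝓛.IsSen (φ i)
  | _, .ex _ φ => 𝓛.hasEx ∧ 𝓛.IsSen φ

/-- The set of the sentences of the fragment over a signature. -/
def sen (𝓛 : Fragment.{u}) (Sg : Signature.{u}) : Set Sg.Sentence := {φ | 𝓛.IsSen φ}

/-- The signature `Sg` has power `α`: there are exactly `α` sentences of the fragment over it. -/
def HasPower (𝓛 : Fragment.{u}) (Sg : Signature.{u}) (α : Cardinal.{u}) : Prop :=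
  Cardinal.mk (𝓛.sen Sg) = Cardinal.lift.{u + 1} α

/-- Compactness: over each signature of the fragment, a set of sentences of the fragment has a
model iff each finite subset of it has a model. -/
def Compact (𝓛 : Fragment.{u}) : Prop :=
  ∀ Sg ∈ 𝓛.sig, ∀ Φ : Set Sg.Sentence, Φ ⊆ 𝓛.sen Sg →
    (Satisfiable Φ ↔ ∀ Ψ ⊆ Φ, Ψ.Finite → Satisfiable Ψ)

/-- `T` is a type, in the variables `X`, for a signature of power `α`. -/
def IsType (𝓛 : Fragment.{u}) (Sg : Signature.{u}) (α : Cardinal.{u}) (X : Sg.Srt → Type u)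
    (T : Set (Sg.extend X).Sentence) : Prop :=
  α ^ Cardinal.mk (Σ s, X s) ≤ α ∧ T ⊆ 𝓛.sen (Sg.extend X)

/-- `Φ` isolates the type `T`, over a signature of power `α`. -/
def Isolates (𝓛 : Fragment.{u}) (Sg : Signature.{u}) (α : Cardinal.{u}) (Φ : Set Sg.Sentence)
    (X : Sg.Srt → Type u) (T : Set (Sg.extend X).Sentence) : Prop :=
  ∃ D : Sg.Srt → Type u, Cardinal.mk (Σ s, D s) < α ∧
  ∃ Γ : Set (Sg.extend D).Sentence, Γ ⊆ 𝓛.sen (Sg.extend D) ∧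
    Cardinal.mk Γ < Cardinal.lift.{u + 1} α ∧
    Satisfiable (Sen.map (incl Sg.Op D) '' Φ ∪ Γ) ∧
  ∃ θ : ∀ s, X s → Term (Ext Sg.Op D) s,
    Entails (Sen.map (incl Sg.Op D) '' Φ ∪ Γ) (Sen.map (substitution θ) '' T)

/-- `Φ` locally omits the type `T`. -/
def LocallyOmits (𝓛 : Fragment.{u}) (Sg : Signature.{u}) (α : Cardinal.{u})
    (Φ : Set Sg.Sentence) (X : Sg.Srt → Type u) (T : Set (Sg.extend X).Sentence) : Prop :=
  ¬ 𝓛.Isolates Sg α Φ X T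

/-- The `α`-omitting types property. -/
def OTP (𝓛 : Fragment.{u}) (α : Cardinal.{u}) : Prop :=
  ∀ Sg ∈ 𝓛.sig, 𝓛.HasPower Sg α →
  ∀ Φ : Set Sg.Sentence, Φ ⊆ 𝓛.sen Sg → Satisfiable Φ →
  ∀ (ι : Type u), Cardinal.mk ι ≤ α →
  ∀ (X : ι → Sg.Srt → Type u) (T : ∀ i, Set (Sg.extend (X i)).Sentence),
    (∀ i, 𝓛.IsType Sg α (X i) (T i)) →
    (∀ i, 𝓛.LocallyOmits Sg α Φ (X i) (T i)) →
  ∃ A : Model Sg.Srt Sg.Lab Sg.Op, Models A Φ ∧ ∀ i, ¬ Realizes A (T i)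

end Fragment

end TA

-- The proof is a Henkin construction of length α with semantic forcing. A condition consists of
-- fewer than α new constants and fewer than α sentences about them; it is consistent if it has a
-- model that also satisfies Φ. Along the ordinals below α one builds an increasing chain of
-- consistent conditions in which every sentence over the constants of some stage is eventually
-- settled, with named witnesses for quantifiers, for the midpoint of a composition and for the
-- points of a path along a star. In the term model of such a chain, a sentence is true iff some
-- condition of the chain forces it, i.e. iff it holds in all models of that condition
-- (`Generic.sat_model`).
--
-- A sentence is settled by a finite extension: take a model of the condition in which it is true,
-- if there is one, and name finitely many elements of that model (`Cond.exists_settles`). The star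
-- is no obstacle, since two points related by it are joined by a finite path, whose edges can be
-- recorded one by one.
--
-- A type is omitted as follows. The sentences of a condition are too few to isolate it, so some
-- model of the condition refutes an instance of the type under a given substitution, and the
-- negation of that instance can be added (`Fragment.exists_finExt_refuting`). By König's theorem,
-- the bound on the number of variables makes it smaller than the cofinality of α, so an assignment
-- in the term model is named at a single stage (`exists_bound_of_power_le`).
--
-- Limit stages do not occur for α = ω. For larger α their consistency follows from compactness,
-- once empty carriers are kept from obstructing the interpretation of new constants
-- (`Cond.consistent_iSup_of_compact`). The bookkeeping requires at most α sentences over each stage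
-- (`Fragment.mk_sen_ext_le`). In a poor fragment the power does not bound the sorts or symbols that
-- no sentence can mention, so new constants are added only at the sorts that may need witnesses.

universe v w

namespace TA

/-! ### Reducts along translations and the invariance of satisfaction. -/

section Reduct

variable {S L : Type u}

/-- The operation that an image of a function symbol denotes in a model. -/
def Img.interp {F : Ops S} (A : Model S L F) : {w : List S} → {s : S} → Img F w s →
    (∀ i : Fin w.length, A.carrier (w.get i)) → A.carrier s
  | _, _, .op f, xs => A.op f xs
  | _, _, .tm t, _ => A.eval t

/-- The reduct of a model along a translation. -/
def Model.reduct {F F' : Ops S} (A : Model S L F') (τ : Transl F F') : Model S L F where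
  carrier := A.carrier
  op := fun f => (τ f).interp A
  rel := A.rel

theorem Model.eval_map {F F' : Ops S} (A : Model S L F') (τ : Transl F F') {s : S}
    (t : Term F s) : A.eval (t.map τ) = (A.reduct τ).eval t := by
  induction t with
  | app f ts ih =>
    simp only [Term.map, Model.eval]
    change A.eval ((τ f).app _) = (τ f).interp A _
    cases h : τ f with
    | op g => simp only [Img.app, Model.eval, Img.interp, ih]
    | tm t => simp only [Img.app, Img.interp]

theorem Model.act_reduct {F F' : Ops S} (A : Model S L F') (τ : Transl F F') (a : Act L) :
    (A.reduct τ).act a = A.act a := by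
  induction a with
  | lab l => rfl
  | comp a b iha ihb => funext s; simp only [Model.act]; rw [iha, ihb]; rfl
  | union a b iha ihb => funext s; simp only [Model.act]; rw [iha, ihb]; rfl
  | star a iha => funext s; simp only [Model.act]; rw [iha]; rfl

theorem Model.act_expand {F : Ops S} (A : Model S L F) {C : S → Type u}
    (v : ∀ s, C s → A.carrier s) (a : Act L) : (A.expand v).act a = A.act a := by
  induction a with
  | lab l => rfl
  | comp a b iha ihb => funext s; simp only [Model.act]; rw [iha, ihb]; rfl
  | union a b iha ihb => funext s; simp only [Model.act]; rw [iha, ihb]; rfl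
  | star a iha => funext s; simp only [Model.act]; rw [iha]; rfl

theorem Img.interp_weaken {F : Ops S} (A : Model S L F) {C : S → Type u}
    (v : ∀ s, C s → A.carrier s) {w : List S} {s : S} (g : Img F w s) :
    (g.weaken C).interp (A.expand v) = g.interp A := by
  cases g with
  | op f => rfl
  | tm t =>
    funext xs
    exact (A.expand v).eval_map (incl F C) t

theorem Model.ext_op {F : Ops S} {c : S → Type u}
    {o o' : ∀ {w : List S} {s : S}, F w s → (∀ i : Fin w.length, c (w.get i)) → c s}
    {r : L → ∀ s : S, c s → c s → Prop} (h : ∀ w s (f : F w s), o f = o' f) :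
    (⟨c, o, r⟩ : Model S L F) = ⟨c, o', r⟩ := by
  have : @o = @o' := by funext w s f; exact h w s f
  subst this; rfl

/-- An equation between two models would change the type of the values, so the carrier is shared
here and only the operations vary. -/
theorem Model.eval_congr_op {F : Ops S} {c : S → Type u}
    {o o' : ∀ {w : List S} {s : S}, F w s → (∀ i : Fin w.length, c (w.get i)) → c s}
    {r : L → ∀ s : S, c s → c s → Prop} (h : ∀ w s (f : F w s), o f = o' f) {s : S}
    (t : Term F s) : (⟨c, o, r⟩ : Model S L F).eval t = (⟨c, o', r⟩ : Model S L F).eval t := by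
  have : @o = @o' := by funext w s f; exact h w s f
  subst this; rfl

theorem Model.reduct_lift {F F' : Ops S} (A : Model S L F') (τ : Transl F F') {C : S → Type u}
    (v : ∀ s, C s → A.carrier s) :
    (A.expand v).reduct (τ.lift C) = (A.reduct τ).expand v := by
  refine Model.ext_op (fun w s f => ?_)
  cases f with
  | old f => exact Img.interp_weaken A v (τ f)
  | new c => rfl

/-- The satisfaction condition. The quantifier step works because forming reducts commutes with
expanding by the bound variables. -/
theorem sat_map {F F' : Ops S} (A : Model S L F') (τ : Transl F F') (φ : Sen S L F) :
    Sat A (φ.map τ) ↔ Sat (A.reduct τ) φ := by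
  induction φ generalizing F' with
  | eq t t' => simp only [Sen.map, Sat, Model.eval_map]; rfl
  | trans a t t' => simp only [Sen.map, Sat, Model.eval_map, Model.act_reduct]
  | neg φ ih => simp only [Sen.map, Sat, ih]
  | disj n φ ih => simp only [Sen.map, Sat, ih]
  | ex X φ ih =>
    simp only [Sen.map, Sat, ih, Model.reduct_lift]
    rfl

theorem Model.exists_eq_expand {F : Ops S} {C : S → Type u} (M : Model S L (Ext F C)) :
    ∃ (A : Model S L F) (v : ∀ s, C s → A.carrier s), M = A.expand v := by
  refine ⟨M.reduct (incl F C), fun s c => M.op (.new c) (fun i => i.elim0), ?_⟩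
  refine Model.ext_op (fun w s f => ?_)
  cases f with
  | old f => rfl
  | new c =>
    funext xs
    have : xs = fun i : Fin 0 => i.elim0 := by funext i; exact i.elim0
    rw [this]
    rfl

/-- The ground term that consists of a new constant. -/
def constTerm {F : Ops S} {C : S → Type u} {s : S} (c : C s) : Term (Ext F C) s :=
  .app (.new c) (fun i => i.elim0)

/-- A translation together with an assignment of terms to new constants. -/
def Transl.extend {F F' : Ops S} (τ : Transl F F') {C : S → Type u}
    (θ : ∀ s, C s → Term F' s) : Transl (Ext F C) F' := fun _ _ f =>
  match f with
  | .old f => τ f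
  | .new c => .tm (θ _ c)

end Reduct

namespace Fragment

variable {S L : Type u} (𝓛 : Fragment.{u})

theorem isSen_map {F F' : Ops S} (τ : Transl F F') (φ : Sen S L F) :
    𝓛.IsSen (φ.map τ) ↔ 𝓛.IsSen φ := by
  induction φ generalizing F' with
  | eq t t' => simp only [Sen.map, IsSen]
  | trans a t t' => simp only [Sen.map, IsSen]
  | neg φ ih => simp only [Sen.map, IsSen, ih]
  | disj n φ ih => simp only [Sen.map, IsSen, ih]
  | ex X φ ih => simp only [Sen.map, IsSen, ih]

end Fragment

end TA

namespace TA

open Cardinal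

/-! ### Reading syntax off sentences, and counting terms by trees. -/

section Counting

variable {S L : Type u}

/-- The leading function symbol of a term. -/
def Term.symb {F : Ops S} : {s : S} → Term F s → Σ w, F w s
  | _, .app f _ => ⟨_, f⟩

/-- The symbol of the original signature behind a symbol of an extension. -/
def Ext.toOld {F : Ops S} {C : S → Type u} : {w : List S} → {s : S} → Ext F C w s →
    Option (Σ w s, F w s)
  | _, _, .old f => some ⟨_, _, f⟩
  | _, _, .new _ => none

/-- The left-hand side of an atomic sentence. -/
def Sen.lhs : {F : Ops S} → Sen S L F → Option (Σ s, Term F s)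
  | _, .eq t _ => some ⟨_, t⟩
  | _, .trans _ t _ => some ⟨_, t⟩
  | _, _ => none

/-- The action of an atomic sentence. -/
def Sen.action : {F : Ops S} → Sen S L F → Option (Act L)
  | _, .trans a _ _ => some a
  | _, _ => none

/-- The block and the body of a quantified sentence. -/
def Sen.body : {F : Ops S} → Sen S L F → Option (Σ X : Block S, Sen S L (Ext F X.fam))
  | _, .ex X φ => some ⟨X, φ⟩
  | _, _ => none

/-- Equations and transitions are the atomic sentences. -/
def Sen.IsAtom : {F : Ops S} → Sen S L F → Prop
  | _, .eq _ _ => True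
  | _, .trans _ _ _ => True
  | _, _ => False

/-- The nesting depth of the sentence operators. -/
def Sen.depth : {F : Ops S} → Sen S L F → ℕ
  | _, .eq _ _ => 0
  | _, .trans _ _ _ => 0
  | _, .neg φ => φ.depth + 1
  | _, .disj _ φ => (Finset.univ.sup fun i => (φ i).depth) + 1
  | _, .ex _ φ => φ.depth + 1

/-- The block that consists of one variable. -/
def Block.single (s : S) : Block S where
  vars := {(0, s)}
  coherent := by
    intro x hx y hy h
    rw [Finset.mem_singleton] at hx hy
    subst hx hy
    exact absurd rfl h

/-- The variable of a block with one variable. -/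
def Block.singleVar (s : S) : (Block.single s).fam s := ⟨0, Finset.mem_singleton_self _⟩

/-- A block of variables for the argument sorts of a function symbol. -/
noncomputable def Block.ofList (w : List S) : Block S where
  vars := by
    classical exact Finset.univ.image fun i : Fin w.length => (i.val, w.get i)
  coherent := by
    intro x hx y hy h
    classical
    rw [Finset.mem_image] at hx hy
    obtain ⟨i, -, rfl⟩ := hx
    obtain ⟨j, -, rfl⟩ := hy
    intro hij
    exact h (congrArg w.get (Fin.ext hij))

/-- The variables of a block for the argument sorts of a function symbol. -/
noncomputable def Block.listVar (w : List S) (i : Fin w.length) :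
    (Block.ofList w).fam (w.get i) :=
  ⟨i.val, by classical exact Finset.mem_image.2 ⟨i, Finset.mem_univ _, rfl⟩⟩

instance Block.finite_fam (X : Block S) : Finite (Σ s, X.fam s) := by
  have : Finite {x : ℕ × S // x ∈ X.vars} := inferInstance
  refine Finite.of_injective
    (fun y : Σ s, X.fam s => (⟨(y.2.down.1, y.1), y.2.down.2⟩ : {x : ℕ × S // x ∈ X.vars})) ?_
  rintro ⟨s, ⟨i, hi⟩⟩ ⟨s', ⟨j, hj⟩⟩ h
  simp only [Subtype.mk.injEq, Prod.mk.injEq] at h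
  obtain ⟨rfl, rfl⟩ := h
  rfl

theorem mk_block_le {α : Cardinal.{u}} (hα : ℵ₀ ≤ α) (hS : #S ≤ α) : #(Block S) ≤ α := by
  have hinj : Function.Injective (Block.vars : Block S → Finset (ℕ × S)) := by
    rintro ⟨a, _⟩ ⟨b, _⟩ h
    cases h
    rfl
  refine (mk_le_of_injective hinj).trans ?_
  rcases isEmpty_or_nonempty S with h | h
  · exact (mk_lt_aleph0 (α := Finset (ℕ × S))).le.trans hα
  · have : Infinite (ℕ × S) := inferInstance
    rw [mk_finset_of_infinite]
    simp only [mk_prod, mk_nat, lift_aleph0, lift_uzero]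
    exact mul_le_of_le hα hα hS

section Terms

/-- The function symbols with arguments of inhabited sorts. -/
abbrev Usable (F : Ops S) : Type u :=
  {x : Σ w s, F w s // ∀ i : Fin x.1.length, Nonempty (Term F (x.1.get i))}

/-- The tree of a term. -/
def Term.tree {F : Ops S} : {s : S} → Term F s →
    WType (fun x : Usable F => ULift.{u} (Fin x.1.1.length))
  | _, .app f ts => ⟨⟨⟨_, _, f⟩, fun i => ⟨ts i⟩⟩, fun i => (ts i.down).tree⟩

theorem Term.tree_injective {F : Ops S} {s : S} (t t' : Term F s) (h : t.tree = t'.tree) :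
    t = t' := by
  induction t with
  | app f ts ih =>
    cases t' with
    | app f' ts' =>
      simp only [Term.tree, WType.mk.injEq, Subtype.mk.injEq, Sigma.mk.injEq] at h
      obtain ⟨⟨rfl, h1⟩, h2⟩ := h
      have h3 := eq_of_heq h1
      simp only [Sigma.mk.injEq, heq_eq_eq, true_and] at h3
      subst h3
      have h4 := eq_of_heq h2
      congr 1
      funext i
      exact ih i _ (congrFun h4 ⟨i⟩)

theorem Term.sort_eq_of_tree_eq {F : Ops S} {s s' : S} (t : Term F s) (t' : Term F s')
    (h : t.tree = t'.tree) : s = s' := by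
  cases t with
  | app f ts =>
    cases t' with
    | app f' ts' =>
      simp only [Term.tree, WType.mk.injEq, Subtype.mk.injEq, Sigma.mk.injEq] at h
      obtain ⟨⟨rfl, h1⟩, h2⟩ := h
      have h3 := eq_of_heq h1
      simp only [Sigma.mk.injEq] at h3
      exact h3.1

/-- Terms embed into a W-type with finite branching. Only symbols whose argument sorts are inhabited
can occur as nodes, so the other symbols need no bound. -/
theorem mk_term_le {α : Cardinal.{u}} (hα : ℵ₀ ≤ α) {F : Ops S} (hF : #(Usable F) ≤ α) :
    #(Σ s, Term F s) ≤ α := by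
  have hinj : Function.Injective (fun x : Σ s, Term F s => x.2.tree) := by
    rintro ⟨s, t⟩ ⟨s', t'⟩ h
    obtain rfl := Term.sort_eq_of_tree_eq t t' h
    rw [Term.tree_injective t t' h]
  refine (mk_le_of_injective hinj).trans ?_
  exact WType.cardinalMk_le_max_aleph0_of_finite.trans (max_le hF hα)

end Terms

end Counting

namespace Fragment

variable {S L : Type u} (𝓛 : Fragment.{u})

/-- Some atomic sentences can be formed from terms. -/
def AtomFormer (L : Type u) : Prop := 𝓛.hasEq ∨ (𝓛.hasTrans ∧ Nonempty L)

variable {𝓛}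

theorem AtomFormer.exists_lhs (h : 𝓛.AtomFormer L) {F : Ops S} {s : S} (t : Term F s) :
    ∃ φ : Sen S L F, 𝓛.IsSen φ ∧ φ.lhs = some ⟨s, t⟩ := by
  rcases h with h | ⟨h, ⟨l⟩⟩
  · exact ⟨.eq t t, h, rfl⟩
  · exact ⟨.trans (.lab l) t t, ⟨h, trivial⟩, rfl⟩

theorem _root_.TA.Act.nonempty_label (a : Act L) : Nonempty L := by
  induction a with
  | lab l => exact ⟨l⟩
  | comp a b iha ihb => exact iha
  | union a b iha ihb => exact iha
  | star a iha => exact iha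

/-- Without atomic sentences no term occurs in a sentence, so a translation has nothing to act on.
-/
theorem map_eq_of_not_atomFormer (h : ¬ 𝓛.AtomFormer L) {F F' : Ops S} (τ τ' : Transl F F')
    (φ : Sen S L F) (hφ : 𝓛.IsSen φ) : φ.map τ = φ.map τ' := by
  induction φ generalizing F' with
  | eq t t' => exact absurd (Or.inl hφ) h
  | trans a t t' => exact absurd (Or.inr ⟨hφ.1, a.nonempty_label⟩) h
  | neg φ ih => simp only [Sen.map]; rw [ih τ τ' hφ.2]
  | disj n φ ih =>
    simp only [Sen.map]
    congr 1
    funext i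
    exact ih i τ τ' (hφ.2 i)
  | ex X φ ih => simp only [Sen.map]; rw [ih _ _ hφ.2]

/-- The source of all bounds extracted from the power: objects that can be decoded from sentences
are no more numerous than the sentences. -/
theorem mk_le_of_code {α : Cardinal.{u}} {F : Ops S}
    (hpow : #{φ : Sen S L F | 𝓛.IsSen φ} ≤ lift.{u + 1} α) {Y : Type u}
    (f : Sen S L F → Option Y) (hf : ∀ y, ∃ φ, 𝓛.IsSen φ ∧ f φ = some y) : #Y ≤ α := by
  choose g hg hfg using hf
  have hinj : Function.Injective (fun y => (⟨g y, hg y⟩ : {φ : Sen S L F | 𝓛.IsSen φ})) := by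
    intro y y' h
    have h' : g y = g y' := congrArg Subtype.val h
    have := hfg y
    rw [h', hfg y'] at this
    exact (Option.some.inj this).symm
  have h := (lift_mk_le_lift_mk_of_injective hinj).trans (lift_le.2 hpow)
  rw [lift_lift] at h
  exact lift_le.1 h

end Fragment

end TA

/-! ### The number of sentences over an extension by constants. -/

namespace TA

open Cardinal

theorem mk_iUnion_le_of_forall {Z : Type u} {ι : Type v} {c : Cardinal.{u}} (hc : ℵ₀ ≤ c)
    (hι : lift.{u} #ι ≤ lift.{v} c) (f : ι → Set Z) (hf : ∀ i, #(f i) ≤ c) :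
    #(⋃ i, f i) ≤ c := by
  have h := (mk_iUnion_le_lift f).trans
    (mul_le_of_le (c := lift.{v} c) (aleph0_le_lift.2 hc) hι (ciSup_le' fun i => lift_le.2 (hf i)))
  exact lift_le.1 h

theorem mk_range_le_of_lift {Y : Type u} {Z : Type (u + 1)} (f : Y → Z) {α : Cardinal.{u}}
    (h : #Y ≤ α) : #(Set.range f) ≤ lift.{u + 1} α := by
  have h' := (mk_range_le_lift (f := f)).trans (lift_le.{u + 1}.2 h)
  rwa [lift_id'.{u, u + 1}] at h'

theorem mk_union_le_of_le {Z : Type u} {c : Cardinal.{u}} (hc : ℵ₀ ≤ c) {A B : Set Z}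
    (hA : #A ≤ c) (hB : #B ≤ c) : #(A ∪ B : Set Z) ≤ c :=
  (mk_union_le A B).trans (add_le_of_le hc hA hB)

variable {S L : Type u}

theorem mk_ext_le {α : Cardinal.{u}} (hα : ℵ₀ ≤ α) {F : Ops S} {C : S → Type u}
    (hF : #(Σ w s, F w s) ≤ α) (hC : #(Σ s, C s) ≤ α) : #(Σ w s, Ext F C w s) ≤ α := by
  let g : (Σ w s, F w s) ⊕ (Σ s, C s) → Σ w s, Ext F C w s :=
    Sum.elim (fun x => ⟨x.1, x.2.1, .old x.2.2⟩) (fun x => ⟨[], x.1, .new x.2⟩)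
  have hg : Function.Surjective g := by
    rintro ⟨w, s, f⟩
    cases f with
    | old f => exact ⟨.inl ⟨w, s, f⟩, rfl⟩
    | new c => exact ⟨.inr ⟨s, c⟩, rfl⟩
  refine (mk_le_of_surjective hg).trans ?_
  rw [mk_sum, lift_id, lift_id]
  exact add_le_of_le hα hF hC

namespace Fragment

variable (𝓛 : Fragment.{u})

/-- Induction on depth: each level adds negations, finite disjunctions and quantified sentences over
the previous one. The body of a quantified sentence lives over a larger signature, so the bound is
proved at once for a class `P` of signatures closed under adding blocks. -/
theorem mk_sen_le {α : Cardinal.{u}} (hα : ℵ₀ ≤ α) (P : Ops S → Prop)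
    (hP : 𝓛.hasEx → ∀ (F : Ops S) (X : Block S), P F → P (Ext F X.fam))
    (hB : 𝓛.hasEx → #(Block S) ≤ α)
    (hat : ∀ F, P F → #{φ : Sen S L F | 𝓛.IsSen φ ∧ φ.IsAtom} ≤ lift.{u + 1} α)
    (F : Ops S) (hF : P F) : #{φ : Sen S L F | 𝓛.IsSen φ} ≤ lift.{u + 1} α := by
  have hα' : ℵ₀ ≤ lift.{u + 1} α := aleph0_le_lift.2 hα
  have key : ∀ n (F : Ops S), P F →
      #{φ : Sen S L F | 𝓛.IsSen φ ∧ φ.depth ≤ n} ≤ lift.{u + 1} α := by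
    intro n
    induction n with
    | zero =>
      intro F hF
      refine (mk_le_mk_of_subset ?_).trans (hat F hF)
      rintro φ ⟨h1, h2⟩
      refine ⟨h1, ?_⟩
      cases φ <;> simp_all [Sen.depth, Sen.IsAtom]
    | succ n ih =>
      intro F hF
      let A : Set (Sen S L F) := {φ | 𝓛.IsSen φ ∧ φ.depth ≤ n}
      let E : Set (Sen S L F) := {φ | 𝓛.IsSen φ ∧ φ.IsAtom}
      let U : Set (Sen S L F) :=
        ⋃ k : ℕ, Set.range fun g : Fin k → A => Sen.disj k fun i => (g i).1
      -- The index type is empty if the fragment has no quantifiers; then no bound on the number of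
      -- blocks is needed.
      let V : Set (Sen S L F) := ⋃ X : {_X : Block S // 𝓛.hasEx},
        Sen.ex X.1 '' {φ : Sen S L (Ext F X.1.fam) | 𝓛.IsSen φ ∧ φ.depth ≤ n}
      have hsub : {φ : Sen S L F | 𝓛.IsSen φ ∧ φ.depth ≤ n + 1} ⊆
          (E ∪ Sen.neg '' A) ∪ (U ∪ V) := by
        rintro φ ⟨h1, h2⟩
        cases φ with
        | eq t t' => exact .inl (.inl ⟨h1, trivial⟩)
        | trans a t t' => exact .inl (.inl ⟨h1, trivial⟩)
        | neg φ => exact .inl (.inr ⟨φ, ⟨h1.2, Nat.le_of_succ_le_succ h2⟩, rfl⟩)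
        | disj k φ =>
          refine .inr (.inl (Set.mem_iUnion.2 ⟨k, ⟨fun i => ⟨φ i, h1.2 i, ?_⟩, rfl⟩⟩))
          exact (Finset.le_sup (f := fun i => (φ i).depth) (Finset.mem_univ i)).trans
            (Nat.le_of_succ_le_succ h2)
        | ex X φ =>
          exact .inr (.inr (Set.mem_iUnion.2
            ⟨⟨X, h1.1⟩, ⟨φ, ⟨h1.2, Nat.le_of_succ_le_succ h2⟩, rfl⟩⟩))
      refine (mk_le_mk_of_subset hsub).trans ?_
      refine mk_union_le_of_le hα' (mk_union_le_of_le hα' (hat F hF) (mk_image_le.trans (ih F hF)))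
        (mk_union_le_of_le hα' ?_ ?_)
      · refine mk_iUnion_le_of_forall hα' (by simpa using hα) _ fun k => ?_
        refine mk_range_le.trans ?_
        rw [mk_arrow, mk_fin, lift_natCast, lift_uzero]
        exact (power_le_power_right (ih F hF)).trans (power_nat_le hα')
      · refine mk_iUnion_le_of_forall hα' ?_ _ fun X => ?_
        · rw [lift_lift, lift_le]
          by_cases h : 𝓛.hasEx
          · exact (mk_subtype_le _).trans (hB h)
          · have : IsEmpty {_X : Block S // 𝓛.hasEx} := ⟨fun x => h x.2⟩
            simp
        · exact mk_image_le.trans (ih _ (hP X.2 F X.1 hF))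
  have hsub : {φ : Sen S L F | 𝓛.IsSen φ} ⊆
      ⋃ n : ℕ, {φ : Sen S L F | 𝓛.IsSen φ ∧ φ.depth ≤ n} :=
    fun φ h => Set.mem_iUnion.2 ⟨φ.depth, h, le_rfl⟩
  exact (mk_le_mk_of_subset hsub).trans
    (mk_iUnion_le_of_forall hα' (by simpa using hα) _ fun n => key n F hF)

variable {𝓛} {α : Cardinal.{u}} {F : Ops S}

theorem mk_sort_le (hpow : #{φ : Sen S L F | 𝓛.IsSen φ} ≤ lift.{u + 1} α)
    (hne : ∃ φ : Sen S L F, 𝓛.IsSen φ) (hex : 𝓛.hasEx) : #S ≤ α := by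
  obtain ⟨φ, hφ⟩ := hne
  refine mk_le_of_code hpow
    (fun z => z.body.bind fun x => (x.1.vars.toList.head?).map Prod.snd) fun s => ?_
  exact ⟨.ex (Block.single s) (φ.map (incl F _)), ⟨hex, (𝓛.isSen_map _ _).2 hφ⟩,
    by simp [Sen.body, Block.single]⟩

theorem mk_symbol_le (hpow : #{φ : Sen S L F | 𝓛.IsSen φ} ≤ lift.{u + 1} α)
    (hex : 𝓛.hasEx) (hat : 𝓛.AtomFormer L) : #(Σ w s, F w s) ≤ α := by
  refine mk_le_of_code hpow
    (fun z => z.body.bind fun x => x.2.lhs.bind fun y => y.2.symb.2.toOld) ?_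
  rintro ⟨w, s, f⟩
  obtain ⟨φ, h1, h2⟩ := hat.exists_lhs
    (Term.app (Ext.old f) fun i => constTerm (F := F) (Block.listVar w i))
  exact ⟨.ex (Block.ofList w) φ, ⟨hex, h1⟩, by simp [Sen.body, h2, Term.symb, Ext.toOld]⟩

/-- Without quantifiers there are no variables to serve as arguments; a symbol is visible in an
atomic sentence only if it can be applied to ground terms. -/
theorem mk_usable_le (hpow : #{φ : Sen S L F | 𝓛.IsSen φ} ≤ lift.{u + 1} α)
    (hat : 𝓛.AtomFormer L) : #(Usable F) ≤ α := by
  classical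
  refine mk_le_of_code hpow
    (fun z => z.lhs.bind fun y =>
      if h : ∀ i : Fin y.2.symb.1.length, Nonempty (Term F (y.2.symb.1.get i)) then
        some ⟨⟨y.2.symb.1, y.1, y.2.symb.2⟩, h⟩ else none) ?_
  rintro ⟨⟨w, s, f⟩, h⟩
  obtain ⟨φ, h1, h2⟩ := hat.exists_lhs (Term.app f fun i => (h i).some)
  refine ⟨φ, h1, ?_⟩
  rw [h2]
  exact dif_pos h

theorem mk_inhabited_le (hpow : #{φ : Sen S L F | 𝓛.IsSen φ} ≤ lift.{u + 1} α)
    (hat : 𝓛.AtomFormer L) : #{s : S // Nonempty (Term F s)} ≤ α := by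
  classical
  refine mk_le_of_code hpow
    (fun z => z.lhs.map fun y => ⟨y.1, ⟨y.2⟩⟩) ?_
  rintro ⟨s, ⟨t⟩⟩
  obtain ⟨φ, h1, h2⟩ := hat.exists_lhs t
  exact ⟨φ, h1, by rw [h2]; rfl⟩

theorem mk_act_le (hpow : #{φ : Sen S L F | 𝓛.IsSen φ} ≤ lift.{u + 1} α) (s : S)
    (hs : 𝓛.hasEx ∨ Nonempty (Term F s)) :
    #{a : Act L // 𝓛.hasTrans ∧ 𝓛.IsAct a} ≤ α := by
  classical
  rcases hs with hex | ⟨⟨t⟩⟩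
  · refine mk_le_of_code hpow (fun z => z.body.bind fun x => x.2.action.bind fun a =>
      if h : 𝓛.hasTrans ∧ 𝓛.IsAct a then some ⟨a, h⟩ else none) ?_
    rintro ⟨a, h⟩
    exact ⟨.ex (Block.single s)
      (.trans a (constTerm (F := F) (Block.singleVar s)) (constTerm (Block.singleVar s))),
      ⟨hex, h⟩, dif_pos h⟩
  · refine mk_le_of_code hpow (fun z => z.action.bind fun a =>
      if h : 𝓛.hasTrans ∧ 𝓛.IsAct a then some ⟨a, h⟩ else none) ?_
    rintro ⟨a, h⟩
    exact ⟨.trans a t t, h, dif_pos h⟩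

/-- The sorts which may need new constants as witnesses. -/
def NeedsConst (𝓛 : Fragment.{u}) (L : Type u) (F : Ops S) (s : S) : Prop :=
  𝓛.hasEx ∨ (𝓛.hasTrans ∧ Nonempty L ∧ Nonempty (Term F s))

theorem mk_needsConst_le (hpow : #{φ : Sen S L F | 𝓛.IsSen φ} ≤ lift.{u + 1} α)
    (hne : ∃ φ : Sen S L F, 𝓛.IsSen φ) : #{s : S // 𝓛.NeedsConst L F s} ≤ α := by
  by_cases hex : 𝓛.hasEx
  · exact (mk_subtype_le _).trans (mk_sort_le hpow hne hex)
  · by_cases h : 𝓛.AtomFormer L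
    · refine (mk_le_of_injective (f := fun s => (⟨s.1, ?_⟩ : {s : S // Nonempty (Term F s)}))
        ?_).trans (mk_inhabited_le hpow h)
      · exact (s.2.resolve_left hex).2.2
      · intro a b hab
        exact Subtype.ext (congrArg (fun x : {s : S // Nonempty (Term F s)} => x.1) hab)
    · have : IsEmpty {s : S // 𝓛.NeedsConst L F s} :=
        ⟨fun s => h (.inr ⟨(s.2.resolve_left hex).1, (s.2.resolve_left hex).2.1⟩)⟩
      simp

/-- In the absence of quantifiers, new constants occur only at sorts that already have ground terms,
so the extension inhabits no further sorts. -/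
theorem nonempty_term_of_ext {C : S → Type u} (hC : ∀ s, Nonempty (C s) → 𝓛.NeedsConst L F s)
    (hex : ¬ 𝓛.hasEx) {s : S} (t : Term (Ext F C) s) : Nonempty (Term F s) := by
  induction t with
  | app f ts ih =>
    cases f with
    | old f => exact ⟨.app f fun i => (ih i).some⟩
    | new c => exact ((hC _ ⟨c⟩).resolve_left hex).2.2

theorem mk_atom_le (hα : ℵ₀ ≤ α) {G : Ops S} (hT : 𝓛.AtomFormer L → #(Σ s, Term G s) ≤ α)
    (hA : ∀ s, Term G s → #{a : Act L // 𝓛.hasTrans ∧ 𝓛.IsAct a} ≤ α) :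
    #{φ : Sen S L G | 𝓛.IsSen φ ∧ φ.IsAtom} ≤ lift.{u + 1} α := by
  by_cases hat : 𝓛.AtomFormer L
  swap
  · have : {φ : Sen S L G | 𝓛.IsSen φ ∧ φ.IsAtom} = ∅ := by
      refine Set.eq_empty_of_forall_notMem ?_
      rintro φ ⟨h1, h2⟩
      cases φ with
      | eq t t' => exact hat (.inl h1)
      | trans a t t' => exact hat (.inr ⟨h1.1, a.nonempty_label⟩)
      | _ => exact h2
    rw [this]; simp
  -- The bound on actions is available only in the presence of a term; without terms there are no
  -- atoms.
  rcases isEmpty_or_nonempty (Σ s, Term G s) with hE | ⟨⟨s, t⟩⟩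
  · have : {φ : Sen S L G | 𝓛.IsSen φ ∧ φ.IsAtom} = ∅ := by
      refine Set.eq_empty_of_forall_notMem ?_
      rintro φ ⟨h1, h2⟩
      cases φ with
      | eq t t' => exact hE.false ⟨_, t⟩
      | trans a t t' => exact hE.false ⟨_, t⟩
      | _ => exact h2
    rw [this]; simp
  have hY : #(Σ s, Term G s × Term G s) ≤ α := by
    refine (mk_le_of_injective (f := fun x : Σ s, Term G s × Term G s =>
      ((⟨x.1, x.2.1⟩ : Σ s, Term G s), (⟨x.1, x.2.2⟩ : Σ s, Term G s))) ?_).trans ?_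
    · rintro ⟨s, a, b⟩ ⟨s', a', b'⟩ h
      simp only [Prod.mk.injEq, Sigma.mk.injEq] at h
      obtain ⟨⟨rfl, h1⟩, -, h2⟩ := h
      rw [eq_of_heq h1, eq_of_heq h2]
    · simp only [mk_prod, lift_id]
      exact mul_le_of_le hα (hT hat) (hT hat)
  have hZ : #({a : Act L // 𝓛.hasTrans ∧ 𝓛.IsAct a} × Σ s, Term G s × Term G s) ≤ α := by
    simp only [mk_prod, lift_id]
    exact mul_le_of_le hα (hA s t) hY
  have hsub : {φ : Sen S L G | 𝓛.IsSen φ ∧ φ.IsAtom} ⊆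
      Set.range (fun y : Σ s, Term G s × Term G s => Sen.eq y.2.1 y.2.2) ∪
      Set.range (fun y : {a : Act L // 𝓛.hasTrans ∧ 𝓛.IsAct a} × Σ s, Term G s × Term G s =>
        Sen.trans y.1.1 y.2.2.1 y.2.2.2) := by
    rintro φ ⟨h1, h2⟩
    cases φ with
    | eq t t' => exact .inl ⟨⟨_, t, t'⟩, rfl⟩
    | trans a t t' => exact .inr ⟨⟨⟨a, h1⟩, _, t, t'⟩, rfl⟩
    | _ => exact h2.elim
  exact (mk_le_mk_of_subset hsub).trans (mk_union_le_of_le (aleph0_le_lift.2 hα)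
    (mk_range_le_of_lift _ hY) (mk_range_le_of_lift _ hZ))

theorem mk_term_ext_le (hα : ℵ₀ ≤ α) (hpow : #{φ : Sen S L F | 𝓛.IsSen φ} ≤ lift.{u + 1} α)
    {C : S → Type u} (hC : #(Σ s, C s) ≤ α)
    (hCn : ∀ s, Nonempty (C s) → 𝓛.NeedsConst L F s) (hat : 𝓛.AtomFormer L) :
    #(Σ s, Term (Ext F C) s) ≤ α := by
  by_cases hex : 𝓛.hasEx
  · exact mk_term_le hα ((mk_subtype_le _).trans (mk_ext_le hα (mk_symbol_le hpow hex hat) hC))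
  · refine mk_term_le hα ?_
    classical
    let g : Usable F ⊕ (Σ s, C s) → Option (Usable (Ext F C)) := fun x => match x with
      | .inl x => if h : ∀ i : Fin x.1.1.length, Nonempty (Term (Ext F C) (x.1.1.get i))
        then some ⟨⟨x.1.1, x.1.2.1, .old x.1.2.2⟩, h⟩ else none
      | .inr x => some ⟨⟨[], x.1, .new x.2⟩, fun i => i.elim0⟩
    have hg : ∀ y, ∃ x, g x = some y := by
      rintro ⟨⟨w, s, f⟩, h⟩
      cases f with
      | old f =>
        refine ⟨.inl ⟨⟨w, s, f⟩, fun i => nonempty_term_of_ext hCn hex (h i).some⟩, ?_⟩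
        exact dif_pos h
      | new c => exact ⟨.inr ⟨s, c⟩, rfl⟩
    choose k hk using hg
    have hinj : Function.Injective k := fun a b hab => by
      have := hk a
      rw [hab, hk b] at this
      exact (Option.some.inj this).symm
    refine (mk_le_of_injective hinj).trans ?_
    rw [mk_sum, lift_id, lift_id]
    exact add_le_of_le hα (mk_usable_le hpow hat) hC

/-- The invariant passed to `mk_sen_le` asks only for what the fragment can express: symbols are
bounded if both quantifiers and atoms exist, terms if atoms exist, actions if there is a term. -/
theorem mk_sen_ext_le (hα : ℵ₀ ≤ α) (hpow : #{φ : Sen S L F | 𝓛.IsSen φ} ≤ lift.{u + 1} α)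
    (hne : ∃ φ : Sen S L F, 𝓛.IsSen φ) {C : S → Type u} (hC : #(Σ s, C s) ≤ α)
    (hCn : ∀ s, Nonempty (C s) → 𝓛.NeedsConst L F s) :
    #{φ : Sen S L (Ext F C) | 𝓛.IsSen φ} ≤ lift.{u + 1} α := by
  refine 𝓛.mk_sen_le hα (fun G => (𝓛.hasEx → 𝓛.AtomFormer L → #(Σ w s, G w s) ≤ α) ∧
    (𝓛.AtomFormer L → #(Σ s, Term G s) ≤ α) ∧
    ∀ s, Term G s → #{a : Act L // 𝓛.hasTrans ∧ 𝓛.IsAct a} ≤ α) ?_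
    (fun hex => mk_block_le hα (mk_sort_le hpow hne hex))
    (fun G hG => mk_atom_le hα hG.2.1 hG.2.2) _ ?_
  · rintro hex G X ⟨h1, h2, h3⟩
    have h : 𝓛.AtomFormer L → #(Σ w s, Ext G X.fam w s) ≤ α := fun hat =>
      mk_ext_le hα (h1 hex hat) (mk_le_aleph0.trans hα)
    exact ⟨fun _ => h, fun hat => mk_term_le hα ((mk_subtype_le _).trans (h hat)),
      fun s _ => mk_act_le hpow s (.inl hex)⟩
  · refine ⟨fun hex hat => mk_ext_le hα (mk_symbol_le hpow hex hat) hC,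
      mk_term_ext_le hα hpow hC hCn, fun s t => mk_act_le hpow s ?_⟩
    by_cases hex : 𝓛.hasEx
    · exact .inl hex
    · exact .inr (nonempty_term_of_ext hCn hex t)

end Fragment

end TA

/-! ### Forcing conditions and their finite extensions inside a fixed model. -/

namespace TA

open Cardinal

variable {S L : Type u} {F : Ops S} {C : S → Type u}

/-- The `S`-sorted set of the members of a set of constants. -/
def fam (D : Set (Σ s, C s)) (s : S) : Type u := {c : C s // (⟨s, c⟩ : Σ s, C s) ∈ D}

/-- The restriction of an interpretation of constants to a smaller set of constants. -/
def res {D D' : Set (Σ s, C s)} (h : D ⊆ D') {B : S → Type u} (v : ∀ s, fam D' s → B s) :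
    ∀ s, fam D s → B s := fun s c => v s ⟨c.1, h c.2⟩

/-- The inclusion of signatures that is induced by an inclusion of sets of constants. -/
def famIncl (F : Ops S) {D D' : Set (Σ s, C s)} (h : D ⊆ D') :
    Transl (Ext F (fam D)) (Ext F (fam D')) := fun _ _ f =>
  match f with
  | .old f => .op (.old f)
  | .new c => .op (.new ⟨c.1, h c.2⟩)

theorem reduct_famIncl {D D' : Set (Σ s, C s)} (h : D ⊆ D') (A : Model S L F)
    (v : ∀ s, fam D' s → A.carrier s) :
    (A.expand v).reduct (famIncl F h) = A.expand (res h v) := by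
  refine Model.ext_op (fun w s f => ?_)
  cases f <;> rfl

theorem eval_map_famIncl {D D' : Set (Σ s, C s)} (h : D ⊆ D') (A : Model S L F)
    (v : ∀ s, fam D' s → A.carrier s) {s : S} (t : Term (Ext F (fam D)) s) :
    (A.expand v).eval (t.map (famIncl F h)) = (A.expand (res h v)).eval t := by
  rw [Model.eval_map]
  refine Model.eval_congr_op (fun w s f => ?_) t
  cases f <;> rfl

theorem sat_map_famIncl {D D' : Set (Σ s, C s)} (h : D ⊆ D') (A : Model S L F)
    (v : ∀ s, fam D' s → A.carrier s) (φ : Sen S L (Ext F (fam D))) :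
    Sat (A.expand v) (φ.map (famIncl F h)) ↔ Sat (A.expand (res h v)) φ := by
  rw [sat_map, reduct_famIncl]

theorem map_map_famIncl {D D' D'' : Set (Σ s, C s)} (h : D ⊆ D') (h' : D' ⊆ D'') {s : S}
    (t : Term (Ext F (fam D)) s) :
    (t.map (famIncl F h)).map (famIncl F h') = t.map (famIncl F (h.trans h')) := by
  induction t with
  | app f ts ih =>
    cases f with
    | old f =>
      change Term.app (Ext.old f) _ = Term.app (Ext.old f) _
      congr 1
      funext i
      exact ih i
    | new c =>
      change Term.app (Ext.new _) _ = Term.app (Ext.new _) _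
      congr 1
      funext i
      exact i.elim0

theorem eval_constTerm {D : S → Type u} (A : Model S L F) (v : ∀ s, D s → A.carrier s) {s : S}
    (c : D s) : (A.expand v).eval (constTerm c) = v s c := rfl

/-- A forcing condition: a set of new constants, and a set of sentences, each one together with a
set of new constants that contains those which occur in it. -/
@[ext]
structure Cond (L : Type u) (F : Ops S) (C : S → Type u) : Type (u + 1) where
  consts : Set (Σ s, C s)
  facts : Set (Σ D : Set (Σ s, C s), Sen S L (Ext F (fam D)))

namespace Cond

/-- The interpretation `v` of the constants makes `A` a model of `Φ` and of the condition. -/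
def Holds (Φ : Set (Sen S L F)) (p : Cond L F C) (A : Model S L F)
    (v : ∀ s, fam p.consts s → A.carrier s) : Prop :=
  Models A Φ ∧ ∀ x ∈ p.facts, ∀ h : x.1 ⊆ p.consts, Sat (A.expand (res h v)) x.2

/-- The condition has a model. -/
def Consistent (Φ : Set (Sen S L F)) (p : Cond L F C) : Prop :=
  ∃ (A : Model S L F) (v : ∀ s, fam p.consts s → A.carrier s), p.Holds Φ A v

/-- The condition consists of sentences of the fragment and has size less than `α`. -/
structure Admissible (𝓛 : Fragment.{u}) (α : Cardinal.{u}) (p : Cond L F C) : Prop where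
  sub : ∀ x ∈ p.facts, x.1 ⊆ p.consts
  isSen : ∀ x ∈ p.facts, 𝓛.IsSen x.2
  consts_lt : #p.consts < α
  facts_lt : #p.facts < lift.{u + 1} α

instance : LE (Cond L F C) := ⟨fun p q => p.consts ⊆ q.consts ∧ p.facts ⊆ q.facts⟩

theorem le_refl (p : Cond L F C) : p ≤ p := ⟨subset_rfl, subset_rfl⟩

theorem le_trans {p q r : Cond L F C} (h : p ≤ q) (h' : q ≤ r) : p ≤ r :=
  ⟨h.1.trans h'.1, h.2.trans h'.2⟩

/-- `q` extends `p` by finitely many constants and sentences. -/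
def FinExt (p q : Cond L F C) : Prop :=
  p ≤ q ∧ (q.consts \ p.consts).Finite ∧ (q.facts \ p.facts).Finite

theorem FinExt.refl (p : Cond L F C) : p.FinExt p := ⟨p.le_refl, by simp, by simp⟩

theorem FinExt.trans {p q r : Cond L F C} (h : p.FinExt q) (h' : q.FinExt r) : p.FinExt r := by
  refine ⟨le_trans h.1 h'.1, (h.2.1.union h'.2.1).subset ?_, (h.2.2.union h'.2.2).subset ?_⟩
  · rintro x ⟨h1, h2⟩
    by_cases hx : x ∈ q.consts
    exacts [.inl ⟨hx, h2⟩, .inr ⟨h1, hx⟩]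
  · rintro x ⟨h1, h2⟩
    by_cases hx : x ∈ q.facts
    exacts [.inl ⟨hx, h2⟩, .inr ⟨h1, hx⟩]

theorem Holds.mono {Φ : Set (Sen S L F)} {p q : Cond L F C} (h : p ≤ q) {A : Model S L F}
    {v : ∀ s, fam q.consts s → A.carrier s} (hv : q.Holds Φ A v) : p.Holds Φ A (res h.1 v) :=
  ⟨hv.1, fun x hx h' => hv.2 x (h.2 hx) (h'.trans h.1)⟩

/-- `q` with the interpretation `w` is an admissible finite extension of `p` with `v`. -/
structure Next (𝓛 : Fragment.{u}) (α : Cardinal.{u}) (Φ : Set (Sen S L F)) (A : Model S L F)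
    (p : Cond L F C) (v : ∀ s, fam p.consts s → A.carrier s)
    (q : Cond L F C) (w : ∀ s, fam q.consts s → A.carrier s) : Prop where
  ext : p.FinExt q
  adm : q.Admissible 𝓛 α
  holds : q.Holds Φ A w
  res_eq : res ext.1.1 w = v

section Steps

variable {𝓛 : Fragment.{u}} {α : Cardinal.{u}} {Φ : Set (Sen S L F)} {A : Model S L F}

theorem Next.refl {p : Cond L F C} {v : ∀ s, fam p.consts s → A.carrier s}
    (hp : p.Admissible 𝓛 α) (hv : p.Holds Φ A v) : Next 𝓛 α Φ A p v p v :=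
  ⟨.refl p, hp, hv, rfl⟩

theorem Next.trans {p q r : Cond L F C} {v : ∀ s, fam p.consts s → A.carrier s}
    {w : ∀ s, fam q.consts s → A.carrier s} {z : ∀ s, fam r.consts s → A.carrier s}
    (h : Next 𝓛 α Φ A p v q w) (h' : Next 𝓛 α Φ A q w r z) : Next 𝓛 α Φ A p v r z := by
  refine ⟨h.ext.trans h'.ext, h'.adm, h'.holds, ?_⟩
  exact (congrArg (res h.ext.1.1) h'.res_eq).trans h.res_eq

/-- Names an element of the model. A fresh constant is left because the condition uses fewer than α
of them. -/
theorem exists_next_const (hα : ℵ₀ ≤ α) {p : Cond L F C}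
    {v : ∀ s, fam p.consts s → A.carrier s} (hp : p.Admissible 𝓛 α) (hv : p.Holds Φ A v) {s : S}
    (hs : α ≤ #(C s)) (a : A.carrier s) :
    ∃ (q : Cond L F C) (w : ∀ s, fam q.consts s → A.carrier s), Next 𝓛 α Φ A p v q w ∧
      ∃ c : fam q.consts s, w s c = a := by
  obtain ⟨c, hc⟩ : ∃ c : C s, (⟨s, c⟩ : Σ s, C s) ∉ p.consts := by
    by_contra hcon
    push Not at hcon
    have : Function.Injective (fun c : C s => (⟨⟨s, c⟩, hcon c⟩ : p.consts)) := by
      intro c c' h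
      simpa using h
    exact absurd (hs.trans (mk_le_of_injective this)) (not_le.2 hp.consts_lt)
  -- The extended interpretation is specified by its two properties and then chosen; heterogeneous
  -- equality is needed because the sort `s'` is `s` only propositionally.
  have key : ∀ s' (c' : fam (insert ⟨s, c⟩ p.consts) s'), ∃ y : A.carrier s',
      (∀ h : ⟨s', c'.1⟩ ∈ p.consts, y = v s' ⟨c'.1, h⟩) ∧
      ((⟨s', c'.1⟩ : Σ s, C s) = ⟨s, c⟩ → HEq y a) := by
    rintro s' ⟨c', hc'⟩
    by_cases h : (⟨s', c'⟩ : Σ s, C s) ∈ p.consts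
    · refine ⟨v s' ⟨c', h⟩, fun _ => rfl, fun h' => ?_⟩
      simp only at h'
      exact absurd (h' ▸ h) hc
    · rcases hc' with hc' | hc'
      · cases hc'
        exact ⟨a, fun h' => absurd h' h, fun _ => HEq.rfl⟩
      · exact absurd hc' h
  choose w hw using key
  have hres : res (Set.subset_insert _ _) w = v := by
    funext s' c'
    exact (hw s' ⟨c'.1, Or.inr c'.2⟩).1 c'.2
  refine ⟨⟨insert ⟨s, c⟩ p.consts, p.facts⟩, w,
    ⟨⟨⟨Set.subset_insert _ _, subset_rfl⟩, ?_, by simp⟩, ⟨?_, hp.isSen, ?_, hp.facts_lt⟩,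
      ⟨hv.1, ?_⟩, hres⟩, ⟨c, Or.inl rfl⟩, ?_⟩
  · exact (Set.finite_singleton (⟨s, c⟩ : Σ s, C s)).subset (by
      rintro x ⟨h1, h2⟩
      exact h1.resolve_right h2)
  · exact fun x hx => (hp.sub x hx).trans (Set.subset_insert _ _)
  · exact mk_insert_le.trans_lt (add_lt_of_lt hα hp.consts_lt (one_lt_aleph0.trans_le hα))
  · intro x hx h
    have := hv.2 x hx (hp.sub x hx)
    rw [← hres] at this
    exact this
  · exact eq_of_heq ((hw s ⟨c, Or.inl rfl⟩).2 rfl)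

/-- The model and the interpretation do not change, so recording a true sentence cannot destroy
consistency. -/
theorem exists_next_fact (hα : ℵ₀ ≤ α) {p : Cond L F C}
    {v : ∀ s, fam p.consts s → A.carrier s} (hp : p.Admissible 𝓛 α) (hv : p.Holds Φ A v)
    {D : Set (Σ s, C s)} (hD : D ⊆ p.consts) (ψ : Sen S L (Ext F (fam D))) (hψ : 𝓛.IsSen ψ)
    (hsat : Sat (A.expand (res hD v)) ψ) :
    ∃ q : Cond L F C, ∃ h : q.consts = p.consts,
      Next 𝓛 α Φ A p v q (res h.subset v) ∧ ⟨D, ψ⟩ ∈ q.facts := by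
  refine ⟨⟨p.consts, insert ⟨D, ψ⟩ p.facts⟩, rfl,
    ⟨⟨⟨subset_rfl, Set.subset_insert _ _⟩, by simp, ?_⟩, ⟨?_, ?_, hp.consts_lt, ?_⟩,
      ⟨hv.1, ?_⟩, rfl⟩, Or.inl rfl⟩
  · refine (Set.finite_singleton (⟨D, ψ⟩ : Σ D : Set (Σ s, C s), Sen S L (Ext F (fam D)))).subset ?_
    rintro x ⟨h1, h2⟩
    exact h1.resolve_right h2
  · rintro x (rfl | hx)
    exacts [hD, hp.sub x hx]
  · rintro x (rfl | hx)
    exacts [hψ, hp.isSen x hx]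
  · exact mk_insert_le.trans_lt (add_lt_of_lt (aleph0_le_lift.2 hα) hp.facts_lt
      (one_lt_aleph0.trans_le (aleph0_le_lift.2 hα)))
  · rintro x (rfl | hx) h
    exacts [hsat, hv.2 x hx h]

/-- In every model of the condition, the action relates the values of the terms. -/
def Edge (Φ : Set (Sen S L F)) (p : Cond L F C) (a : Act L) {s : S}
    (x y : Term (Ext F (fam p.consts)) s) : Prop :=
  ∀ (A : Model S L F) (v : ∀ s, fam p.consts s → A.carrier s), p.Holds Φ A v →
    A.act a s ((A.expand v).eval x) ((A.expand v).eval y)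

theorem Edge.mono {p q : Cond L F C} (h : p ≤ q) {a : Act L} {s : S}
    {x y : Term (Ext F (fam p.consts)) s} (hxy : p.Edge Φ a x y) :
    q.Edge Φ a (x.map (famIncl F h.1)) (y.map (famIncl F h.1)) := by
  intro A v hv
  rw [eval_map_famIncl, eval_map_famIncl]
  exact hxy A _ (hv.mono h)

/-- The condition provides witnesses for quantified sentences and for composed actions. -/
def Witnesses (Φ : Set (Sen S L F)) (p : Cond L F C) {D : Set (Σ s, C s)} (h : D ⊆ p.consts) :
    Sen S L (Ext F (fam D)) → Prop
  | .ex X χ => ∃ θ : ∀ s, X.fam s → fam p.consts s,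
      ∀ (A : Model S L F) (v : ∀ s, fam p.consts s → A.carrier s), p.Holds Φ A v →
        Sat ((A.expand (res h v)).expand fun s x => v s (θ s x)) χ
  | .trans (.comp a b) t t' => ∃ c,
      p.Edge Φ a (t.map (famIncl F h)) c ∧ p.Edge Φ b c (t'.map (famIncl F h))
  | .trans (.star a) t t' =>
      (∀ (A : Model S L F) (v : ∀ s, fam p.consts s → A.carrier s), p.Holds Φ A v →
        (A.expand (res h v)).eval t = (A.expand (res h v)).eval t') ∨
      Relation.TransGen (p.Edge Φ a) (t.map (famIncl F h)) (t'.map (famIncl F h))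
  | _ => True

/-- The condition decides the sentence, and provides witnesses for it if it is true. -/
def Settles (Φ : Set (Sen S L F)) (p : Cond L F C) {D : Set (Σ s, C s)}
    (ψ : Sen S L (Ext F (fam D))) : Prop :=
  ∃ h : D ⊆ p.consts,
    (∀ (A : Model S L F) (v : ∀ s, fam p.consts s → A.carrier s), p.Holds Φ A v →
      ¬ Sat (A.expand (res h v)) ψ) ∨
    ((∀ (A : Model S L F) (v : ∀ s, fam p.consts s → A.carrier s), p.Holds Φ A v →
      Sat (A.expand (res h v)) ψ) ∧ p.Witnesses Φ h ψ)

end Steps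

end Cond

end TA

/-! ### Settling a sentence by a finite extension. -/

namespace TA

open Cardinal

variable {S L : Type u} {F : Ops S} {C : S → Type u}

theorem Fragment.needsConst_of_term {𝓛 : Fragment.{u}}
    (hC : ∀ s, Nonempty (C s) → 𝓛.NeedsConst L F s) (htr : 𝓛.hasTrans) (a : Act L)
    {D : Set (Σ s, C s)} {s : S} (t : Term (Ext F (fam D)) s) : 𝓛.NeedsConst L F s := by
  by_cases hex : 𝓛.hasEx
  · exact .inl hex
  · exact .inr ⟨htr, a.nonempty_label,
      Fragment.nonempty_term_of_ext (fun s hs => hC s (hs.map Subtype.val)) hex t⟩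

theorem reduct_famIncl_extend {D D' : Set (Σ s, C s)} (h : D ⊆ D') {X : S → Type u}
    (A : Model S L F) (v : ∀ s, fam D' s → A.carrier s) (θ : ∀ s, X s → Term (Ext F (fam D')) s) :
    (A.expand v).reduct ((famIncl F h).extend θ) =
      (A.expand (res h v)).expand fun s x => (A.expand v).eval (θ s x) := by
  refine Model.ext_op (fun w s f => ?_)
  cases f with
  | old f => cases f <;> rfl
  | new c => rfl

namespace Cond

variable {𝓛 : Fragment.{u}} {α : Cardinal.{u}} {Φ : Set (Sen S L F)}

theorem Next.eval_map {A : Model S L F} {p q : Cond L F C}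
    {v : ∀ s, fam p.consts s → A.carrier s} {w : ∀ s, fam q.consts s → A.carrier s}
    (h : Next 𝓛 α Φ A p v q w) {s : S} (t : Term (Ext F (fam p.consts)) s) :
    (A.expand w).eval (t.map (famIncl F h.ext.1.1)) = (A.expand v).eval t := by
  obtain ⟨h1, h2, h3, rfl⟩ := h
  exact eval_map_famIncl _ _ _ _

theorem Next.sat_iff {A : Model S L F} {p q : Cond L F C}
    {v : ∀ s, fam p.consts s → A.carrier s} {w : ∀ s, fam q.consts s → A.carrier s}
    (h : Next 𝓛 α Φ A p v q w) {D : Set (Σ s, C s)} (hD : D ⊆ p.consts)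
    (ψ : Sen S L (Ext F (fam D))) :
    Sat (A.expand (res (hD.trans h.ext.1.1) w)) ψ ↔ Sat (A.expand (res hD v)) ψ := by
  obtain ⟨h1, h2, h3, rfl⟩ := h
  exact Iff.rfl

theorem edge_of_mem {q : Cond L F C} {D : Set (Σ s, C s)} (h : D ⊆ q.consts) {a : Act L} {s : S}
    {t t' : Term (Ext F (fam D)) s} (hmem : ⟨D, .trans a t t'⟩ ∈ q.facts) :
    q.Edge Φ a (t.map (famIncl F h)) (t'.map (famIncl F h)) := by
  intro A v hv
  have := hv.2 _ hmem h
  simp only [Sat, Model.act_expand] at this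
  rw [eval_map_famIncl, eval_map_famIncl]
  exact this

theorem exists_next_edge (hα : ℵ₀ ≤ α) {A : Model S L F} {p : Cond L F C}
    {v : ∀ s, fam p.consts s → A.carrier s} (hp : p.Admissible 𝓛 α) (hv : p.Holds Φ A v)
    {a : Act L} (ha : 𝓛.hasTrans ∧ 𝓛.IsAct a) {s : S} (t t' : Term (Ext F (fam p.consts)) s)
    (h : A.act a s ((A.expand v).eval t) ((A.expand v).eval t')) :
    ∃ (q : Cond L F C) (w : ∀ s, fam q.consts s → A.carrier s) (hq : Next 𝓛 α Φ A p v q w),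
      q.Edge Φ a (t.map (famIncl F hq.ext.1.1)) (t'.map (famIncl F hq.ext.1.1)) := by
  obtain ⟨q, hqc, hq, hmem⟩ := exists_next_fact hα hp hv subset_rfl (.trans a t t') ha (by
    simp only [Sat, Model.act_expand]
    exact h)
  exact ⟨q, _, hq, edge_of_mem _ hmem⟩

/-- Induction along the path: name the next point, record the edge to it and continue. The
conditions and terms are quantified after the path because each step replaces them by larger ones.
-/
theorem exists_next_path (hα : ℵ₀ ≤ α) {A : Model S L F} {s : S} (hs : α ≤ #(C s))
    {a : Act L} (ha : 𝓛.hasTrans ∧ 𝓛.IsAct a) {x y : A.carrier s}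
    (hxy : Relation.TransGen (A.act a s) x y) : ∀ {p : Cond L F C}
    {v : ∀ s, fam p.consts s → A.carrier s} (_ : p.Admissible 𝓛 α) (_ : p.Holds Φ A v)
    (t t' : Term (Ext F (fam p.consts)) s), (A.expand v).eval t = x → (A.expand v).eval t' = y →
    ∃ (q : Cond L F C) (w : ∀ s, fam q.consts s → A.carrier s) (hq : Next 𝓛 α Φ A p v q w),
      Relation.TransGen (q.Edge Φ a) (t.map (famIncl F hq.ext.1.1))
        (t'.map (famIncl F hq.ext.1.1)) := by
  induction hxy using Relation.TransGen.head_induction_on with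
  | single h =>
    rintro p v hp hv t t' rfl rfl
    obtain ⟨q, w, hq, he⟩ := exists_next_edge hα hp hv ha t t' h
    exact ⟨q, w, hq, .single he⟩
  | head h _ ih =>
    rintro p v hp hv t t' rfl rfl
    obtain ⟨q₁, w₁, hq₁, c, hc⟩ := exists_next_const hα hp hv hs _
    obtain ⟨q₂, w₂, hq₂, he⟩ := exists_next_edge hα hq₁.adm hq₁.holds ha
      (t.map (famIncl F hq₁.ext.1.1)) (constTerm c) (by
        rw [hq₁.eval_map, eval_constTerm, hc]
        exact h)
    obtain ⟨q₃, w₃, hq₃, hp₃⟩ := ih hq₂.adm hq₂.holds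
      ((constTerm c).map (famIncl F hq₂.ext.1.1))
      ((t'.map (famIncl F hq₁.ext.1.1)).map (famIncl F hq₂.ext.1.1))
      (by rw [hq₂.eval_map, eval_constTerm, hc]) (by rw [hq₂.eval_map, hq₁.eval_map])
    refine ⟨q₃, w₃, (hq₁.trans hq₂).trans hq₃, ?_⟩
    have := Relation.TransGen.head (he.mono hq₃.ext.1) hp₃
    simp only [map_map_famIncl] at this
    exact this

theorem exists_next_family (hα : ℵ₀ ≤ α) {A : Model S L F} {X : S → Type u} [Finite (Σ s, X s)]
    (hs : ∀ s, X s → α ≤ #(C s)) (b : ∀ s, X s → A.carrier s) {p : Cond L F C}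
    {v : ∀ s, fam p.consts s → A.carrier s} (hp : p.Admissible 𝓛 α) (hv : p.Holds Φ A v) :
    ∃ (q : Cond L F C) (w : ∀ s, fam q.consts s → A.carrier s), Next 𝓛 α Φ A p v q w ∧
      ∃ θ : ∀ s, X s → fam q.consts s, ∀ s x, w s (θ s x) = b s x := by
  classical
  have key : ∀ Y : Finset (Σ s, X s),
      ∃ (q : Cond L F C) (w : ∀ s, fam q.consts s → A.carrier s), Next 𝓛 α Φ A p v q w ∧
        ∀ y ∈ Y, ∃ c : fam q.consts y.1, w y.1 c = b y.1 y.2 := by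
    intro Y
    induction Y using Finset.induction_on with
    | empty => exact ⟨p, v, .refl hp hv, by simp⟩
    | insert y Y _ ih =>
      obtain ⟨q, w, hq, h⟩ := ih
      obtain ⟨q', w', hq', c, hc⟩ := exists_next_const hα hq.adm hq.holds (hs y.1 y.2) (b y.1 y.2)
      refine ⟨q', w', hq.trans hq', fun z hz => ?_⟩
      rcases Finset.mem_insert.1 hz with rfl | hz
      · exact ⟨c, hc⟩
      · obtain ⟨d, hd⟩ := h z hz
        refine ⟨⟨d.1, hq'.ext.1.1 d.2⟩, ?_⟩
        rw [← hd]
        exact congrFun (congrFun hq'.res_eq z.1) d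
  have := Fintype.ofFinite (Σ s, X s)
  obtain ⟨q, w, hq, h⟩ := key Finset.univ
  choose θ hθ using fun s x => h ⟨s, x⟩ (Finset.mem_univ _)
  exact ⟨q, w, hq, θ, hθ⟩

/-- A sentence that fails in all models of the condition is already refuted. Otherwise it is added,
with witnesses taken from a model where it is true. No negated sentence has to be added. -/
theorem exists_settles (hα : ℵ₀ ≤ α) (hfresh : ∀ s, 𝓛.NeedsConst L F s → α ≤ #(C s))
    (hC : ∀ s, Nonempty (C s) → 𝓛.NeedsConst L F s) {p : Cond L F C} (hp : p.Admissible 𝓛 α)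
    (hcons : p.Consistent Φ) {D : Set (Σ s, C s)} (hD : D ⊆ p.consts)
    (ψ : Sen S L (Ext F (fam D))) (hψ : 𝓛.IsSen ψ) :
    ∃ q : Cond L F C, p.FinExt q ∧ q.Admissible 𝓛 α ∧ q.Consistent Φ ∧ q.Settles Φ ψ := by
  by_cases hsat : ∃ (A : Model S L F) (v : ∀ s, fam p.consts s → A.carrier s),
      p.Holds Φ A v ∧ Sat (A.expand (res hD v)) ψ
  swap
  · push Not at hsat
    exact ⟨p, .refl p, hp, hcons, hD, .inl hsat⟩
  -- Once the sentence is a fact, every model of a later condition satisfies it; only the witnesses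
  -- remain. The model is left free because the star case prefers a particular one.
  have reduction : ∀ (A : Model S L F) (v : ∀ s, fam p.consts s → A.carrier s),
      p.Holds Φ A v → Sat (A.expand (res hD v)) ψ →
      (∀ (q : Cond L F C) (w : ∀ s, fam q.consts s → A.carrier s) (h : Next 𝓛 α Φ A p v q w),
        ∃ (q' : Cond L F C) (w' : ∀ s, fam q'.consts s → A.carrier s)
          (h' : Next 𝓛 α Φ A q w q' w'),
          q'.Witnesses Φ (hD.trans (h.trans h').ext.1.1) ψ) →
      ∃ q : Cond L F C, p.FinExt q ∧ q.Admissible 𝓛 α ∧ q.Consistent Φ ∧ q.Settles Φ ψ := by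
    intro A v hv hvψ hw
    obtain ⟨q, hqc, hq, hmem⟩ := exists_next_fact hα hp hv hD ψ hψ hvψ
    obtain ⟨q', w', hq', hwit⟩ := hw q _ hq
    exact ⟨q', (hq.trans hq').ext, hq'.adm, ⟨A, w', hq'.holds⟩, _,
      .inr ⟨fun B z hz => hz.2 _ (hq'.ext.1.2 hmem) _, hwit⟩⟩
  obtain ⟨A, v, hv, hvψ⟩ := hsat
  match ψ, hψ, hvψ, reduction with
  | .eq t t', _, hvψ, reduction =>
    exact reduction A v hv hvψ fun q w h => ⟨q, w, .refl h.adm h.holds, trivial⟩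
  | .neg φ, _, hvψ, reduction =>
    exact reduction A v hv hvψ fun q w h => ⟨q, w, .refl h.adm h.holds, trivial⟩
  | .disj n φ, _, hvψ, reduction =>
    exact reduction A v hv hvψ fun q w h => ⟨q, w, .refl h.adm h.holds, trivial⟩
  | .trans (.lab l) t t', _, hvψ, reduction =>
    exact reduction A v hv hvψ fun q w h => ⟨q, w, .refl h.adm h.holds, trivial⟩
  | .trans (.union a b) t t', _, hvψ, reduction =>
    exact reduction A v hv hvψ fun q w h => ⟨q, w, .refl h.adm h.holds, trivial⟩
  | .trans (.comp a b) t t', hψ, hvψ, reduction =>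
    refine reduction A v hv hvψ fun q w h => ?_
    have hs := hfresh _ (Fragment.needsConst_of_term hC hψ.1 a t)
    rw [← h.sat_iff] at hvψ
    simp only [Sat, Model.act_expand, Model.act] at hvψ
    obtain ⟨z, hz₁, hz₂⟩ := hvψ
    obtain ⟨q₁, w₁, h₁, c, rfl⟩ := exists_next_const hα h.adm h.holds hs z
    have hD₁ := hD.trans (h.trans h₁).ext.1.1
    obtain ⟨q₂, w₂, h₂, e₂⟩ := exists_next_edge hα h₁.adm h₁.holds ⟨hψ.1, hψ.2.2.1⟩
      (t.map (famIncl F hD₁)) (constTerm c) (by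
        rw [← map_map_famIncl (hD.trans h.ext.1.1) h₁.ext.1.1, h₁.eval_map, eval_map_famIncl]
        exact hz₁)
    obtain ⟨q₃, w₃, h₃, e₃⟩ := exists_next_edge hα h₂.adm h₂.holds ⟨hψ.1, hψ.2.2.2⟩
      ((constTerm c).map (famIncl F h₂.ext.1.1)) (t'.map (famIncl F (hD₁.trans h₂.ext.1.1))) (by
        rw [h₂.eval_map, ← map_map_famIncl hD₁ h₂.ext.1.1, h₂.eval_map,
          ← map_map_famIncl (hD.trans h.ext.1.1) h₁.ext.1.1, h₁.eval_map, eval_map_famIncl]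
        exact hz₂)
    refine ⟨q₃, w₃, (h₁.trans h₂).trans h₃,
      (constTerm c).map (famIncl F (h₂.trans h₃).ext.1.1), ?_, ?_⟩
    · have := e₂.mono h₃.ext.1
      simp only [map_map_famIncl] at this
      exact this
    · simp only [map_map_famIncl] at e₃
      exact e₃
  | .trans (.star a) t t', hψ, hvψ, reduction =>
    have hs := hfresh _ (Fragment.needsConst_of_term hC hψ.1 a t)
    -- If some model has a path of positive length, its edges are recorded. If none has, the star
    -- can hold only through equality, which is thus forced although the fragment may have no
    -- equations.
    by_cases hpath : ∃ (A : Model S L F) (v : ∀ s, fam p.consts s → A.carrier s),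
        p.Holds Φ A v ∧ Relation.TransGen (A.act a _)
          ((A.expand (res hD v)).eval t) ((A.expand (res hD v)).eval t')
    · obtain ⟨B, z, hz, hpath⟩ := hpath
      refine reduction B z hz ?_ fun q w h => ?_
      · simp only [Sat, Model.act_expand, Model.act]
        exact hpath.to_reflTransGen
      · obtain ⟨q', w', h', hq'⟩ := exists_next_path hα hs ⟨hψ.1, hψ.2.2⟩ hpath h.adm h.holds
          (t.map (famIncl F (hD.trans h.ext.1.1))) (t'.map (famIncl F (hD.trans h.ext.1.1)))
          (by rw [← map_map_famIncl hD h.ext.1.1, h.eval_map, eval_map_famIncl])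
          (by rw [← map_map_famIncl hD h.ext.1.1, h.eval_map, eval_map_famIncl])
        simp only [map_map_famIncl] at hq'
        exact ⟨q', w', h', .inr hq'⟩
    · push Not at hpath
      obtain ⟨q, hqc, hq, hmem⟩ := exists_next_fact hα hp hv hD _ hψ hvψ
      refine ⟨q, hq.ext, hq.adm, ⟨A, _, hq.holds⟩, hD.trans hq.ext.1.1,
        .inr ⟨fun B z hz => hz.2 _ hmem _, .inl fun B z hz => ?_⟩⟩
      have h1 := hz.2 _ hmem (hD.trans hq.ext.1.1)
      simp only [Sat, Model.act_expand, Model.act] at h1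
      rcases Relation.reflTransGen_iff_eq_or_transGen.1 h1 with h2 | h2
      · exact h2.symm
      · exact absurd h2 (hpath B _ (hz.mono hq.ext.1))
  | .ex X χ, hψ, hvψ, reduction =>
    refine reduction A v hv hvψ fun q w h => ?_
    rw [← h.sat_iff] at hvψ
    obtain ⟨b, hb⟩ := hvψ
    obtain ⟨q₁, w₁, h₁, θ, hθ⟩ := exists_next_family (A := A) hα (fun s _ => hfresh s (.inl hψ.1)) b
      h.adm h.holds
    have hD₁ := hD.trans (h.trans h₁).ext.1.1
    have hmodel : ∀ (B : Model S L F) (z : ∀ s, fam q₁.consts s → B.carrier s),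
        Sat (B.expand z) (χ.map ((famIncl F hD₁).extend fun s x => constTerm (θ s x))) ↔
          Sat ((B.expand (res hD₁ z)).expand fun s x => z s (θ s x)) χ := by
      intro B z
      rw [sat_map, reduct_famIncl_extend]
      rfl
    -- The recorded fact is the body with the constants that name its witnesses in place of the
    -- bound variables.
    obtain ⟨q₂, hc, h₂, hmem⟩ := exists_next_fact hα h₁.adm h₁.holds subset_rfl
      (χ.map ((famIncl F hD₁).extend fun s x => constTerm (θ s x)))
      ((𝓛.isSen_map _ _).2 hψ.2) ((hmodel A w₁).2 (by
        have e : (fun s x => w₁ s (θ s x)) = b := by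
          funext s x
          exact hθ s x
        rw [e]
        obtain ⟨k1, k2, k3, rfl⟩ := h₁
        exact hb))
    refine ⟨q₂, _, h₁.trans h₂, fun s x => ⟨(θ s x).1, h₂.ext.1.1 (θ s x).2⟩, fun B z hz => ?_⟩
    exact (hmodel B (res h₂.ext.1.1 z)).1 (hz.2 _ hmem h₂.ext.1.1)

end Cond

end TA

/-! ### Generic families and their term models. -/

namespace TA

open Cardinal

variable {S L : Type u} {F : Ops S} {C : S → Type u}

/-- Translation of images of function symbols. -/
def Img.map {F F' : Ops S} (σ : Transl F F') : {w : List S} → {s : S} → Img F w s → Img F' w s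
  | _, _, .op f => σ f
  | _, _, .tm t => .tm (t.map σ)

/-- A translation into the signature with the constants `D`, continued to a larger set of
constants and extended by terms for further constants. -/
def Transl.enlarge {F' : Ops S} {D D' : Set (Σ s, C s)} (h : D ⊆ D')
    (τ : Transl F' (Ext F (fam D))) {X : S → Type u} (θ : ∀ s, X s → Term (Ext F (fam D')) s) :
    Transl (Ext F' X) (Ext F (fam D')) :=
  Transl.extend (fun _ _ f => (τ f).map (famIncl F h)) θ

theorem reduct_enlarge {F' : Ops S} {D D' : Set (Σ s, C s)} (h : D ⊆ D')
    (τ : Transl F' (Ext F (fam D))) {X : S → Type u} (θ : ∀ s, X s → Term (Ext F (fam D')) s)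
    (A : Model S L F) (v : ∀ s, fam D' s → A.carrier s) :
    (A.expand v).reduct (τ.enlarge h θ) =
      ((A.expand (res h v)).reduct τ).expand fun s x => (A.expand v).eval (θ s x) := by
  refine Model.ext_op (fun w s f => ?_)
  cases f with
  | old f =>
    change ((τ f).map (famIncl F h)).interp (A.expand v) = (τ f).interp (A.expand (res h v))
    generalize τ f = k
    cases k with
    | op f => cases f <;> rfl
    | tm t =>
      funext xs
      exact eval_map_famIncl h A v t
  | new c => rfl

/-- An increasing family of consistent conditions that settles all sentences of the fragment. -/
structure Generic (𝓛 : Fragment.{u}) (Φ : Set (Sen S L F)) {K : Type u} [LinearOrder K]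
    (p : K → Cond L F C) : Prop where
  mono : ∀ {γ β}, γ ≤ β → p γ ≤ p β
  consistent : ∀ β, (p β).Consistent Φ
  settles : ∀ γ (ψ : Sen S L (Ext F (fam (p γ).consts))), 𝓛.IsSen ψ →
    ∃ β, γ ≤ β ∧ (p β).Settles Φ ψ

namespace Generic

variable {𝓛 : Fragment.{u}} {Φ : Set (Sen S L F)} {K : Type u} [LinearOrder K]
  {p : K → Cond L F C} (g : Generic 𝓛 Φ p)

/-- Terms are equivalent if some condition forces them to have the same value. -/
def setoid (s : S) : Setoid (Σ γ, Term (Ext F (fam (p γ).consts)) s) where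
  r x y := ∃ β, ∃ (h : x.1 ≤ β) (h' : y.1 ≤ β),
    ∀ (A : Model S L F) (v : ∀ s, fam (p β).consts s → A.carrier s), (p β).Holds Φ A v →
      (A.expand (res (g.mono h).1 v)).eval x.2 = (A.expand (res (g.mono h').1 v)).eval y.2
  iseqv := by
    refine ⟨fun x => ⟨x.1, le_rfl, le_rfl, fun _ _ _ => rfl⟩,
      fun ⟨β, h, h', e⟩ => ⟨β, h', h, fun A v hv => (e A v hv).symm⟩, ?_⟩
    rintro x y z ⟨β, h, h', e⟩ ⟨β', k, k', e'⟩
    refine ⟨max β β', h.trans (le_max_left _ _), k'.trans (le_max_right _ _), fun A v hv => ?_⟩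
    exact (e A _ (hv.mono (g.mono (le_max_left _ _)))).trans
      (e' A _ (hv.mono (g.mono (le_max_right _ _))))

/-- The class of a term. -/
def cls (γ : K) {s : S} (t : Term (Ext F (fam (p γ).consts)) s) : Quotient (g.setoid s) :=
  Quotient.mk _ ⟨γ, t⟩

theorem cls_eq_cls {γ γ' : K} {s : S} {t : Term (Ext F (fam (p γ).consts)) s}
    {t' : Term (Ext F (fam (p γ').consts)) s} :
    g.cls γ t = g.cls γ' t' ↔ ∃ β, ∃ (h : γ ≤ β) (h' : γ' ≤ β),
    ∀ (A : Model S L F) (v : ∀ s, fam (p β).consts s → A.carrier s), (p β).Holds Φ A v →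
      (A.expand (res (g.mono h).1 v)).eval t = (A.expand (res (g.mono h').1 v)).eval t' :=
  Quotient.eq

theorem cls_map {γ β : K} (h : γ ≤ β) {s : S} (t : Term (Ext F (fam (p γ).consts)) s) :
    g.cls β (t.map (famIncl F (g.mono h).1)) = g.cls γ t :=
  g.cls_eq_cls.2 ⟨β, le_rfl, h, fun A _ _ => eval_map_famIncl _ A _ t⟩

/-- Each element is named at some stage; a bound for these stages lets all terms be moved to a
common one. The index type is left general to cover finite blocks and the infinitely many variables
of a type. -/
theorem exists_reps {I : Type v} (hI : ∀ f : I → K, ∃ β, ∀ i, f i ≤ β) (γ : K) (σ : I → S)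
    (xs : ∀ i, Quotient (g.setoid (σ i))) :
    ∃ β, γ ≤ β ∧ ∃ ts : ∀ i, Term (Ext F (fam (p β).consts)) (σ i), ∀ i, g.cls β (ts i) = xs i := by
  choose ys hys using fun i => (xs i).exists_rep
  obtain ⟨β, hβ⟩ := hI fun i => (ys i).1
  refine ⟨max γ β, le_max_left _ _, fun i =>
    (ys i).2.map (famIncl F (g.mono ((hβ i).trans (le_max_right _ _))).1), fun i => ?_⟩
  exact (g.cls_map ((hβ i).trans (le_max_right _ _)) _).trans (hys i)

theorem exists_reps_fin {n : ℕ} (γ : K) (σ : Fin n → S) (xs : ∀ i, Quotient (g.setoid (σ i))) :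
    ∃ β, γ ≤ β ∧ ∃ ts : ∀ i, Term (Ext F (fam (p β).consts)) (σ i), ∀ i, g.cls β (ts i) = xs i :=
  have : Nonempty K := ⟨γ⟩
  g.exists_reps (fun f => Finite.exists_le f) γ σ xs

/-- A forced sentence cannot be settled negatively, since both stages lie below a consistent one; so
the stage that settles it supplies witnesses. -/
theorem exists_decide {γ : K} (ψ : Sen S L (Ext F (fam (p γ).consts))) (hψ : 𝓛.IsSen ψ)
    (hf : ∃ β, ∃ h : γ ≤ β,
      ∀ (A : Model S L F) (v : ∀ s, fam (p β).consts s → A.carrier s), (p β).Holds Φ A v →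
        Sat (A.expand (res (g.mono h).1 v)) ψ) :
    ∃ β, ∃ h : γ ≤ β,
      (∀ (A : Model S L F) (v : ∀ s, fam (p β).consts s → A.carrier s), (p β).Holds Φ A v →
        Sat (A.expand (res (g.mono h).1 v)) ψ) ∧ (p β).Witnesses Φ (g.mono h).1 ψ := by
  obtain ⟨β, h, k, hs⟩ := g.settles γ ψ hψ
  rcases hs with hs | hs
  · obtain ⟨β', h', H⟩ := hf
    obtain ⟨A, v, hv⟩ := g.consistent (max β β')
    exact absurd (H A _ (hv.mono (g.mono (le_max_right _ _))))
      (hs A _ (hv.mono (g.mono (le_max_left _ _))))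
  · exact ⟨β, h, hs⟩


/-- Some condition forces the action to relate terms of the given classes. -/
def Related (a : Act L) {s : S} (x y : Quotient (g.setoid s)) : Prop :=
  ∃ β, ∃ t t' : Term (Ext F (fam (p β).consts)) s,
    g.cls β t = x ∧ g.cls β t' = y ∧ (p β).Edge Φ a t t'

/-- Independence of representatives: a later stage forces the representatives in `Related` to agree
with the given terms. -/
theorem related_cls {a : Act L} {γ : K} {s : S} {t t' : Term (Ext F (fam (p γ).consts)) s} :
    g.Related a (g.cls γ t) (g.cls γ t') ↔ ∃ β, ∃ h : γ ≤ β,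
      ∀ (A : Model S L F) (v : ∀ s, fam (p β).consts s → A.carrier s), (p β).Holds Φ A v →
        A.act a s ((A.expand (res (g.mono h).1 v)).eval t)
          ((A.expand (res (g.mono h).1 v)).eval t') := by
  constructor
  · rintro ⟨β, u, u', e, e', h⟩
    obtain ⟨β₁, h₁, k₁, e₁⟩ := g.cls_eq_cls.1 e
    obtain ⟨β₂, h₂, k₂, e₂⟩ := g.cls_eq_cls.1 e'
    refine ⟨max β₁ β₂, k₁.trans (le_max_left _ _), fun A v hv => ?_⟩
    have l₁ := e₁ A _ (hv.mono (g.mono (le_max_left _ _)))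
    have l₂ := e₂ A _ (hv.mono (g.mono (le_max_right _ _)))
    have l₃ := h A _ (hv.mono (g.mono (h₁.trans (le_max_left β₁ β₂))))
    have l₄ := (congrArg₂ (A.act a s) l₁ l₂).mp l₃
    exact l₄
  · rintro ⟨β, h, H⟩
    refine ⟨β, t.map (famIncl F (g.mono h).1), t'.map (famIncl F (g.mono h).1), g.cls_map h t,
      g.cls_map h t', fun A v hv => ?_⟩
    rw [eval_map_famIncl, eval_map_famIncl]
    exact H A v hv

variable [Nonempty K]

/-- The term model of a generic family of conditions. -/
noncomputable def model : Model S L F where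
  carrier s := Quotient (g.setoid s)
  op {w _} f xs :=
    have h := g.exists_reps_fin (Classical.arbitrary K) w.get xs
    g.cls h.choose (.app (.old f) h.choose_spec.2.choose)
  rel l _ x y := g.Related (.lab l) x y

/-- The operation was defined through arbitrary representatives. The finitely many equations between
these and the given ones are forced at a common stage. -/
theorem op_cls {w : List S} {s : S} (f : F w s) {γ : K}
    (ts : ∀ i : Fin w.length, Term (Ext F (fam (p γ).consts)) (w.get i)) :
    g.model.op f (fun i => g.cls γ (ts i)) = g.cls γ (.app (.old f) ts) := by
  have h := g.exists_reps_fin (Classical.arbitrary K) w.get (fun i => g.cls γ (ts i))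
  change g.cls h.choose (.app (.old f) h.choose_spec.2.choose) = _
  have h1 := h.choose_spec.2.choose_spec
  generalize h.choose_spec.2.choose = ts' at h1
  generalize h.choose = β at ts' h1
  choose δ hδ hδ' e using fun i => g.cls_eq_cls.1 (h1 i)
  obtain ⟨M, hM⟩ := Finite.exists_le δ
  let N := max M (max β γ)
  have hN : ∀ i, δ i ≤ N := fun i => (hM i).trans (le_max_left _ _)
  refine g.cls_eq_cls.2 ⟨N, (le_max_left _ _).trans (le_max_right _ _),
    (le_max_right _ _).trans (le_max_right _ _), fun A v hv => ?_⟩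
  change A.op f _ = A.op f _
  congr 1
  funext i
  exact e i A _ (hv.mono (g.mono (hN i)))

/-- The interpretation of the constants of a condition in the term model. -/
def val (γ : K) (s : S) (c : fam (p γ).consts s) : g.model.carrier s := g.cls γ (constTerm c)

theorem eval_model (γ : K) {s : S} (t : Term (Ext F (fam (p γ).consts)) s) :
    (g.model.expand (g.val γ)).eval t = g.cls γ t := by
  induction t with
  | app f ts ih =>
    cases f with
    | old f =>
      rw [← g.op_cls]
      change g.model.op f _ = _
      congr 1
      funext i
      exact ih i
    | new c =>
      have : ts = fun i : Fin 0 => i.elim0 := by funext i; exact i.elim0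
      rw [this]
      rfl

theorem res_val {γ β : K} (h : γ ≤ β) : res (g.mono h).1 (g.val β) = g.val γ := by
  funext s c
  refine Eq.trans ?_ (g.cls_map h (constTerm c))
  refine congrArg (g.cls β) ?_
  change Term.app (Ext.new _) _ = Term.app (Ext.new _) _
  congr 1
  funext i
  exact i.elim0

/-- From the model to forcing, finitely many forced facts are combined at a later stage. From
forcing to the model, composition and star use the recorded witnesses, and union settles both of its
parts. -/
theorem act_model {a : Act L} (htr : 𝓛.hasTrans) (ha : 𝓛.IsAct a) {s : S}
    (x y : g.model.carrier s) : g.model.act a s x y ↔ g.Related a x y := by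
  induction a generalizing x y with
  | lab l => exact Iff.rfl
  | comp a b iha ihb =>
    constructor
    · rintro ⟨z, h₁, h₂⟩
      obtain ⟨γ, -, ts, hts⟩ := g.exists_reps_fin (Classical.arbitrary K) (fun _ : Fin 3 => s)
        ![x, y, z]
      obtain rfl : g.cls γ (ts 0) = x := hts 0
      obtain rfl : g.cls γ (ts 1) = y := hts 1
      obtain rfl : g.cls γ (ts 2) = z := hts 2
      obtain ⟨β₁, k₁, H₁⟩ := g.related_cls.1 ((iha ha.2.1 _ _).1 h₁)
      obtain ⟨β₂, k₂, H₂⟩ := g.related_cls.1 ((ihb ha.2.2 _ _).1 h₂)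
      refine g.related_cls.2 ⟨max β₁ β₂, k₁.trans (le_max_left _ _), fun A v hv => ?_⟩
      exact ⟨_, H₁ A _ (hv.mono (g.mono (le_max_left _ _))),
        H₂ A _ (hv.mono (g.mono (le_max_right _ _)))⟩
    · rintro ⟨γ, t, t', rfl, rfl, h⟩
      obtain ⟨β, k, -, c, h₁, h₂⟩ := g.exists_decide (.trans (.comp a b) t t') ⟨htr, ha⟩
        ⟨γ, le_rfl, fun A v hv => by simp only [Sat, Model.act_expand]; exact h A v hv⟩
      refine ⟨g.cls β c, (iha ha.2.1 _ _).2 ⟨β, _, _, g.cls_map k t, rfl, h₁⟩,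
        (ihb ha.2.2 _ _).2 ⟨β, _, _, rfl, g.cls_map k t', h₂⟩⟩
  | union a b iha ihb =>
    constructor
    · rintro (h | h)
      · obtain ⟨β, t, t', e, e', H⟩ := (iha ha.2.1 _ _).1 h
        exact ⟨β, t, t', e, e', fun A v hv => .inl (H A v hv)⟩
      · obtain ⟨β, t, t', e, e', H⟩ := (ihb ha.2.2 _ _).1 h
        exact ⟨β, t, t', e, e', fun A v hv => .inr (H A v hv)⟩
    · rintro ⟨γ, t, t', rfl, rfl, h⟩
      obtain ⟨β₁, k₁, d₁, H₁⟩ := g.settles γ (.trans a t t') ⟨htr, ha.2.1⟩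
      obtain ⟨β₂, k₂, d₂, H₂⟩ := g.settles γ (.trans b t t') ⟨htr, ha.2.2⟩
      simp only [Sat, Model.act_expand] at H₁ H₂
      rcases H₁ with H₁ | H₁
      · rcases H₂ with H₂ | H₂
        -- Both parts of the union are refuted although the union is forced, which is impossible in
        -- a model of a common later stage.
        · obtain ⟨A, v, hv⟩ := g.consistent (max β₁ β₂)
          rcases h A _ (hv.mono (g.mono (k₁.trans (le_max_left _ _)))) with h' | h'
          · exact absurd h' (H₁ A _ (hv.mono (g.mono (le_max_left _ _))))
          · exact absurd h' (H₂ A _ (hv.mono (g.mono (le_max_right _ _))))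
        · exact .inr ((ihb ha.2.2 _ _).2 (g.related_cls.2 ⟨β₂, k₂, H₂.1⟩))
      · exact .inl ((iha ha.2.1 _ _).2 (g.related_cls.2 ⟨β₁, k₁, H₁.1⟩))
  | star a iha =>
    constructor
    · intro h
      change Relation.ReflTransGen (g.model.act a s) x y at h
      induction h using Relation.ReflTransGen.head_induction_on with
      | refl =>
        obtain ⟨⟨γ, t⟩, rfl⟩ := y.exists_rep
        exact ⟨γ, t, t, rfl, rfl, fun A v hv => .refl⟩
      | @head x z h₁ _ h₂ =>
        obtain ⟨γ, -, ts, hts⟩ := g.exists_reps_fin (Classical.arbitrary K) (fun _ : Fin 3 => s)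
          ![x, y, z]
        obtain rfl : g.cls γ (ts 0) = x := hts 0
        obtain rfl : g.cls γ (ts 1) = y := hts 1
        obtain rfl : g.cls γ (ts 2) = z := hts 2
        obtain ⟨β₁, k₁, H₁⟩ := g.related_cls.1 ((iha ha.2 _ _).1 h₁)
        obtain ⟨β₂, k₂, H₂⟩ := g.related_cls.1 h₂
        refine g.related_cls.2 ⟨max β₁ β₂, k₁.trans (le_max_left _ _), fun A v hv => ?_⟩
        exact .head (H₁ A _ (hv.mono (g.mono (le_max_left _ _))))
          (H₂ A _ (hv.mono (g.mono (le_max_right _ _))))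
    · rintro ⟨γ, t, t', rfl, rfl, h⟩
      change Relation.ReflTransGen (g.model.act a s) _ _
      obtain ⟨β, k, -, hw⟩ := g.exists_decide (.trans (.star a) t t') ⟨htr, ha⟩
        ⟨γ, le_rfl, fun A v hv => by simp only [Sat, Model.act_expand]; exact h A v hv⟩
      rcases hw with hw | hw
      · rw [g.cls_eq_cls.2 ⟨β, k, k, hw⟩]
        exact .refl
      · rw [← g.cls_map k t, ← g.cls_map k t']
        refine (Relation.TransGen.lift (g.cls β) (fun t t' h => ?_) _ _ hw).to_reflTransGen
        exact (iha ha.2 _ _).2 ⟨β, t, t', rfl, rfl, h⟩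

theorem eval_model_reduct {F' : Ops S} (γ : K) (τ : Transl F' (Ext F (fam (p γ).consts))) {s : S}
    (t : Term F' s) : ((g.model.expand (g.val γ)).reduct τ).eval t = g.cls γ (t.map τ) := by
  rw [← g.eval_model]
  exact ((g.model.expand (g.val γ)).eval_map τ t).symm

/-- The truth lemma. It is stated for translations into the language of a stage because quantified
bodies live over larger signatures; their variables are absorbed into `τ` by `Transl.enlarge`. -/
theorem sat_model {F' : Ops S} (φ : Sen S L F') (hφ : 𝓛.IsSen φ) (γ : K)
    (τ : Transl F' (Ext F (fam (p γ).consts))) :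
    Sat ((g.model.expand (g.val γ)).reduct τ) φ ↔ ∃ β, ∃ h : γ ≤ β,
      ∀ (A : Model S L F) (v : ∀ s, fam (p β).consts s → A.carrier s), (p β).Holds Φ A v →
        Sat ((A.expand (res (g.mono h).1 v)).reduct τ) φ := by
  induction φ generalizing γ with
  | eq t t' =>
    simp only [Sat]
    rw [g.eval_model_reduct, g.eval_model_reduct]
    refine g.cls_eq_cls.trans ?_
    simp only [Model.eval_map]
    exact ⟨fun ⟨β, h, _, H⟩ => ⟨β, h, H⟩, fun ⟨β, h, H⟩ => ⟨β, h, h, H⟩⟩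
  | trans a t t' =>
    simp only [Sat, Model.act_reduct, Model.act_expand]
    rw [g.eval_model_reduct, g.eval_model_reduct]
    refine (g.act_model hφ.1 hφ.2 _ _).trans (g.related_cls.trans ?_)
    simp only [Model.eval_map]
  | neg φ ih =>
    simp only [Sat]
    rw [ih hφ.2]
    constructor
    · intro h
      obtain ⟨β, k, d, H⟩ := g.settles γ (φ.map τ) ((𝓛.isSen_map _ _).2 hφ.2)
      simp only [sat_map] at H
      rcases H with H | H
      · exact ⟨β, k, H⟩
      · exact absurd ⟨β, k, H.1⟩ h
    · rintro ⟨β, h, H⟩ ⟨β', h', H'⟩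
      obtain ⟨A, v, hv⟩ := g.consistent (max β β')
      exact H A _ (hv.mono (g.mono (le_max_left _ _)))
        (H' A _ (hv.mono (g.mono (le_max_right _ _))))
  | disj n φ ih =>
    simp only [Sat]
    constructor
    · rintro ⟨i, h⟩
      obtain ⟨β, k, H⟩ := (ih i (hφ.2 i) γ τ).1 h
      exact ⟨β, k, fun A v hv => ⟨i, H A v hv⟩⟩
    · rintro ⟨β, h, H⟩
      by_contra hcon
      have : ∀ i, ∃ δ, ∃ k : γ ≤ δ,
          ∀ (A : Model S L F) (v : ∀ s, fam (p δ).consts s → A.carrier s), (p δ).Holds Φ A v →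
            ¬ Sat ((A.expand (res (g.mono k).1 v)).reduct τ) (φ i) := by
        intro i
        obtain ⟨δ, k, d, H'⟩ := g.settles γ ((φ i).map τ) ((𝓛.isSen_map _ _).2 (hφ.2 i))
        simp only [sat_map] at H'
        rcases H' with H' | H'
        · exact ⟨δ, k, H'⟩
        · exact absurd ⟨i, (ih i (hφ.2 i) γ τ).2 ⟨δ, k, H'.1⟩⟩ hcon
      -- There are finitely many disjuncts, so they are all refuted at one stage, against the forced
      -- disjunction.
      choose δ k H' using this
      obtain ⟨M, hM⟩ := Finite.exists_le δ
      obtain ⟨A, v, hv⟩ := g.consistent (max β M)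
      obtain ⟨i, hi⟩ := H A _ (hv.mono (g.mono (le_max_left _ _)))
      exact H' i A _ (hv.mono (g.mono ((hM i).trans (le_max_right _ _)))) hi
  | ex X χ ih =>
    constructor
    · rintro ⟨v, hv⟩
      obtain ⟨β, k, θ, hθ⟩ := g.exists_reps (I := Σ s, X.fam s) (fun f => Finite.exists_le f) γ
        (fun x => x.1) (fun x => v x.1 x.2)
      have e := reduct_enlarge (g.mono k).1 τ (fun s x => θ ⟨s, x⟩) g.model (g.val β)
      have e' : (fun s x => (g.model.expand (g.val β)).eval (θ ⟨s, x⟩)) = v := by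
        funext s x
        rw [g.eval_model]
        exact hθ ⟨s, x⟩
      rw [g.res_val k] at e
      erw [e'] at e
      rw [← e, ih hφ.2] at hv
      obtain ⟨δ, h, H⟩ := hv
      refine ⟨δ, k.trans h, fun A z hz => ?_⟩
      have := H A z hz
      rw [reduct_enlarge] at this
      exact ⟨_, this⟩
    · intro h
      obtain ⟨β, k, -, θ, H⟩ := g.exists_decide ((Sen.ex X χ).map τ) ((𝓛.isSen_map _ _).2 hφ) (by
        simp only [sat_map]
        exact h)
      have e := reduct_enlarge (g.mono k).1 τ (fun s x => constTerm (θ s x)) g.model (g.val β)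
      rw [g.res_val k] at e
      have hχ : Sat ((g.model.expand (g.val β)).reduct
          (τ.enlarge (g.mono k).1 fun s x => constTerm (θ s x))) χ := by
        rw [ih hφ.2]
        refine ⟨β, le_rfl, fun A z hz => ?_⟩
        rw [reduct_enlarge]
        have e' := Model.reduct_lift (A.expand (res (g.mono k).1 z)) τ (fun s x => z s (θ s x))
        exact (congrArg (fun M => Sat M χ) e').mp ((sat_map _ _ _).1 (H A z hz))
      rw [e] at hχ
      exact ⟨_, hχ⟩

end Generic

end TA

/-! ### Transfinite recursion with bookkeeping. -/

namespace TA

open Cardinal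

section Recursion

theorem exists_rec_of_local {K : Type u} [LinearOrder K] [WellFoundedLT K] {V : Type v}
    [Nonempty V] (P : K → (K → V) → V → Prop)
    (hloc : ∀ β g g' x, (∀ δ < β, g δ = g' δ) → P β g x → P β g' x)
    (hex : ∀ β g, ∃ x, P β g x) : ∃ g : K → V, ∀ β, P β g (g β) := by
  classical
  choose f hf using hex
  let H : (β : K) → ((δ : K) → δ < β → V) → V := fun β r =>
    f β fun δ => if h : δ < β then r δ h else Classical.arbitrary V
  let g : K → V := wellFounded_lt.fix H
  refine ⟨g, fun β => ?_⟩
  have hg : g β = H β fun δ _ => g δ := wellFounded_lt.fix_eq H β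
  rw [hg]
  refine hloc β _ g _ (fun δ hδ => ?_) (hf β _)
  exact dif_pos hδ

/-- For α = ω the union is a finite union of finite sets; for larger α its size is at most ℵ₀ times
that of the index type. No regularity of α is used, which is why the steps of the chain are kept
finite. -/
theorem mk_iUnion_finite_lt {α : Cardinal.{u}} (hα : ℵ₀ ≤ α) {Z : Type v} {ι : Type u}
    (hι : #ι < α) (f : ι → Set Z) (hf : ∀ i, (f i).Finite) :
    lift.{u} #(⋃ i, f i) < lift.{v} α := by
  rcases hα.eq_or_lt with rfl | h
  · have : Finite ι := lt_aleph0_iff_finite.1 hι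
    rw [lift_aleph0, lift_lt_aleph0, lt_aleph0_iff_set_finite]
    exact Set.finite_iUnion hf
  · refine (mk_iUnion_le_lift f).trans_lt ?_
    refine (mul_le_mul_right (ciSup_le' (a := ℵ₀) fun i => ?_) _).trans_lt
      (mul_lt_of_lt (aleph0_le_lift.2 hα) (lift_lt.2 hι) (by rwa [aleph0_lt_lift]))
    rw [lift_le_aleph0]
    exact (lt_aleph0_iff_set_finite.2 (hf i)).le

/-- Enumerate the tasks paired with an idle coordinate from α: each task then appears α times,
whereas an initial segment has fewer than α places. -/
theorem exists_task {α : Cardinal.{u}} (hα : ℵ₀ ≤ α) {J : Type u} [Nonempty J] (hJ : #J ≤ α) :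
    ∃ task : α.ord.ToType → α.ord.ToType × J, ∀ x γ, ∃ β, γ < β ∧ task β = x := by
  have hne : Nonempty α.ord.ToType := by
    rw [← mk_ne_zero_iff, mk_ord_toType]
    exact (aleph0_pos.trans_le hα).ne'
  have hle : #((α.ord.ToType × J) × α.ord.ToType) ≤ #α.ord.ToType := by
    simp only [mk_prod, lift_id, mk_ord_toType]
    exact mul_le_of_le hα (mul_le_of_le hα le_rfl hJ) le_rfl
  obtain ⟨f⟩ := hle
  obtain ⟨e, he⟩ : ∃ e : α.ord.ToType → (α.ord.ToType × J) × α.ord.ToType,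
      Function.Surjective e := ⟨Function.invFun f, Function.invFun_surjective f.injective⟩
  refine ⟨fun β => (e β).1, fun x γ => ?_⟩
  by_contra hcon
  push Not at hcon
  choose k hk using fun y => he (x, y)
  have hinj : Function.Injective k := fun a b hab => by
    have := hk a
    rw [hab, hk b] at this
    exact (Prod.mk.inj this).2.symm
  have hsub : Set.range k ⊆ insert γ (Set.Iio γ) := by
    rintro _ ⟨y, rfl⟩
    rcases lt_or_ge γ (k y) with h | h
    · exact absurd (congrArg Prod.fst (hk y)) (hcon _ h)
    · exact h.eq_or_lt
  have h1 := mk_le_mk_of_subset hsub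
  rw [mk_range_eq k hinj, mk_ord_toType] at h1
  exact absurd h1 (not_le.2 (mk_insert_le.trans_lt (add_lt_of_lt hα (by simpa using mk_Iio_lt γ)
    (one_lt_aleph0.trans_le hα))))

end Recursion

namespace Cond

variable {S L : Type u} {F : Ops S} {C : S → Type u}

/-- The union of a family of conditions. -/
def iSup {I : Type u} (q : I → Cond L F C) : Cond L F C :=
  ⟨⋃ i, (q i).consts, ⋃ i, (q i).facts⟩

/-- The union of the conditions with indices in a set. -/
def upto {K : Type u} (g : K → Cond L F C) (s : Set K) : Cond L F C :=
  iSup fun δ : s => g δ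

theorem upto_mono {K : Type u} (g : K → Cond L F C) {s t : Set K} (h : s ⊆ t) :
    upto g s ≤ upto g t := by
  constructor
  · exact Set.iUnion_subset fun i => Set.subset_iUnion (fun δ : t => (g δ).consts) ⟨i.1, h i.2⟩
  · exact Set.iUnion_subset fun i => Set.subset_iUnion (fun δ : t => (g δ).facts) ⟨i.1, h i.2⟩

theorem upto_congr {K : Type u} {g g' : K → Cond L F C} {s : Set K} (h : ∀ δ ∈ s, g δ = g' δ) :
    upto g s = upto g' s := by
  refine Cond.ext ?_ ?_
  · exact Set.iUnion_congr fun δ => congrArg Cond.consts (h δ δ.2)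
  · exact Set.iUnion_congr fun δ => congrArg Cond.facts (h δ δ.2)

/-- The union of two conditions. -/
def add (p x : Cond L F C) : Cond L F C := ⟨p.consts ∪ x.consts, p.facts ∪ x.facts⟩

theorem upto_Iic {K : Type u} [LinearOrder K] (g : K → Cond L F C) (β : K) :
    upto g (Set.Iic β) = (upto g (Set.Iio β)).add (g β) := by
  refine Cond.ext ?_ ?_
  · ext x
    simp only [upto, iSup, add, Set.mem_iUnion, Set.mem_union, Subtype.exists, exists_prop,
      Set.mem_Iic, Set.mem_Iio]
    constructor
    · rintro ⟨δ, hδ, hx⟩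
      rcases hδ.eq_or_lt with rfl | hδ
      exacts [.inr hx, .inl ⟨δ, hδ, hx⟩]
    · rintro (⟨δ, hδ, hx⟩ | hx)
      exacts [⟨δ, hδ.le, hx⟩, ⟨β, le_rfl, hx⟩]
  · ext x
    simp only [upto, iSup, add, Set.mem_iUnion, Set.mem_union, Subtype.exists, exists_prop,
      Set.mem_Iic, Set.mem_Iio]
    constructor
    · rintro ⟨δ, hδ, hx⟩
      rcases hδ.eq_or_lt with rfl | hδ
      exacts [.inr hx, .inl ⟨δ, hδ, hx⟩]
    · rintro (⟨δ, hδ, hx⟩ | hx)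
      exacts [⟨δ, hδ.le, hx⟩, ⟨β, le_rfl, hx⟩]

theorem upto_Iio {K : Type u} [LinearOrder K] (g : K → Cond L F C) (β : K) :
    upto g (Set.Iio β) = iSup fun δ : Set.Iio β => upto g (Set.Iic (δ : K)) := by
  refine Cond.ext ?_ ?_
  · ext x
    simp only [upto, iSup, Set.mem_iUnion, Subtype.exists, exists_prop,
      Set.mem_Iic, Set.mem_Iio]
    exact ⟨fun ⟨δ, hδ, hx⟩ => ⟨δ, hδ, δ, le_rfl, hx⟩,
      fun ⟨δ, hδ, ε, hε, hx⟩ => ⟨ε, hε.trans_lt hδ, hx⟩⟩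
  · ext x
    simp only [upto, iSup, Set.mem_iUnion, Subtype.exists, exists_prop,
      Set.mem_Iic, Set.mem_Iio]
    exact ⟨fun ⟨δ, hδ, hx⟩ => ⟨δ, hδ, δ, le_rfl, hx⟩,
      fun ⟨δ, hδ, ε, hε, hx⟩ => ⟨ε, hε.trans_lt hδ, hx⟩⟩

theorem FinExt.exists_add {p q : Cond L F C} (h : p.FinExt q) :
    ∃ x : Cond L F C, x.consts.Finite ∧ x.facts.Finite ∧ p.add x = q :=
  ⟨⟨q.consts \ p.consts, q.facts \ p.facts⟩, h.2.1, h.2.2,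
    Cond.ext (Set.union_sdiff_cancel h.1.1) (Set.union_sdiff_cancel h.1.2)⟩

/-- Consistent admissible conditions can be met one after the other: given goals that are reached
by finite extensions, there is a chain of conditions in which every goal is reached. -/
theorem exists_chain {𝓛 : Fragment.{u}} {α : Cardinal.{u}} (hα : ℵ₀ ≤ α) {Φ : Set (Sen S L F)}
    {J : Type u} [Nonempty J] (hJ : #J ≤ α) (goal : Set (Σ s, C s) → J → Cond L F C → Prop)
    (hgoal : ∀ p : Cond L F C, p.Admissible 𝓛 α → p.Consistent Φ → ∀ D ⊆ p.consts, ∀ j,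
      ∃ q : Cond L F C, p.FinExt q ∧ q.Admissible 𝓛 α ∧ q.Consistent Φ ∧ goal D j q)
    (hlim : ∀ (β : α.ord.ToType) (q : α.ord.ToType → Cond L F C),
      (∀ γ δ, γ ≤ δ → q γ ≤ q δ) →
      (∀ γ < β, (q γ).Admissible 𝓛 α ∧ (q γ).Consistent Φ) →
      (iSup fun δ : Set.Iio β => q δ).Consistent Φ) :
    ∃ q : α.ord.ToType → Cond L F C, (∀ γ δ, γ ≤ δ → q γ ≤ q δ) ∧ (∀ β, (q β).Consistent Φ) ∧
      ∀ γ j, ∃ β, γ ≤ β ∧ goal (q γ).consts j (q β) := by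
  obtain ⟨task, htask⟩ := exists_task hα hJ
  -- The recursion chooses finite increments, not the conditions themselves. Its demands are
  -- conditional on the union of the earlier increments being good, so a choice exists even before
  -- that is known; `key` discharges the condition afterwards.
  let P : α.ord.ToType → (α.ord.ToType → Cond L F C) → Cond L F C → Prop := fun β g x =>
    x.consts.Finite ∧ x.facts.Finite ∧
    ((upto g (Set.Iio β)).Admissible 𝓛 α → (upto g (Set.Iio β)).Consistent Φ →
      ((upto g (Set.Iio β)).add x).Admissible 𝓛 α ∧ ((upto g (Set.Iio β)).add x).Consistent Φ ∧
      ((task β).1 < β → goal (upto g (Set.Iic (task β).1)).consts (task β).2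
        ((upto g (Set.Iio β)).add x)))
  have : Nonempty (Cond L F C) := ⟨⟨∅, ∅⟩⟩
  obtain ⟨g, hg⟩ := exists_rec_of_local P (by
    rintro β g g' x h ⟨h1, h2, h3⟩
    refine ⟨h1, h2, ?_⟩
    rw [upto_congr (s := Set.Iio β) h] at h3
    refine fun ha hc => ⟨(h3 ha hc).1, (h3 ha hc).2.1, fun hlt => ?_⟩
    have := (h3 ha hc).2.2 hlt
    rwa [upto_congr (s := Set.Iic (task β).1) fun δ hδ => h δ (lt_of_le_of_lt hδ hlt)] at this) (by
    intro β g
    by_cases ha : (upto g (Set.Iio β)).Admissible 𝓛 α ∧ (upto g (Set.Iio β)).Consistent Φ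
    · by_cases hlt : (task β).1 < β
      · obtain ⟨q, h1, h2, h3, h4⟩ := hgoal _ ha.1 ha.2 (upto g (Set.Iic (task β).1)).consts
          (upto_mono g (Set.Iic_subset_Iio.2 hlt)).1 (task β).2
        obtain ⟨x, hx1, hx2, rfl⟩ := h1.exists_add
        exact ⟨x, hx1, hx2, fun _ _ => ⟨h2, h3, fun _ => h4⟩⟩
      · refine ⟨⟨∅, ∅⟩, Set.finite_empty, Set.finite_empty, fun _ _ => ?_⟩
        have e : (upto g (Set.Iio β)).add ⟨∅, ∅⟩ = upto g (Set.Iio β) :=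
          Cond.ext (Set.union_empty _) (Set.union_empty _)
        rw [e]
        exact ⟨ha.1, ha.2, fun h => absurd h hlt⟩
    · exact ⟨⟨∅, ∅⟩, Set.finite_empty, Set.finite_empty, fun h1 h2 => absurd ⟨h1, h2⟩ ha⟩)
  have hmono : ∀ γ δ, γ ≤ δ → upto g (Set.Iic γ) ≤ upto g (Set.Iic δ) := fun γ δ h =>
    upto_mono g (Set.Iic_subset_Iic.2 h)
  have key : ∀ β, (upto g (Set.Iio β)).Admissible 𝓛 α ∧ (upto g (Set.Iio β)).Consistent Φ := by
    intro β
    induction β using WellFoundedLT.induction with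
    | ind β ih =>
      have hq : ∀ γ < β, (upto g (Set.Iic γ)).Admissible 𝓛 α ∧
          (upto g (Set.Iic γ)).Consistent Φ := by
        intro γ hγ
        rw [upto_Iic]
        have := (hg γ).2.2 (ih γ hγ).1 (ih γ hγ).2
        exact ⟨this.1, this.2.1⟩
      refine ⟨⟨?_, ?_, ?_, ?_⟩, ?_⟩
      · rw [upto_Iio]
        intro x hx
        obtain ⟨⟨γ, hγ⟩, hx⟩ := Set.mem_iUnion.1 hx
        exact ((hq γ hγ).1.sub x hx).trans
          (Set.subset_iUnion (fun δ : Set.Iio β => (upto g (Set.Iic (δ : _))).consts) ⟨γ, hγ⟩)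
      · rw [upto_Iio]
        intro x hx
        obtain ⟨⟨γ, hγ⟩, hx⟩ := Set.mem_iUnion.1 hx
        exact (hq γ hγ).1.isSen x hx
      · have := mk_iUnion_finite_lt hα (ι := Set.Iio β) (by simpa using mk_Iio_lt β)
          (fun δ => (g δ).consts) fun δ => (hg δ).1
        rwa [lift_id, lift_id] at this
      · have := mk_iUnion_finite_lt hα (ι := Set.Iio β) (by simpa using mk_Iio_lt β)
          (fun δ => (g δ).facts) fun δ => (hg δ).2.1
        rwa [lift_id'.{u, u + 1}] at this
      · rw [upto_Iio]
        exact hlim β (fun δ => upto g (Set.Iic δ)) hmono hq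
  refine ⟨fun β => upto g (Set.Iic β), hmono, fun β => ?_, fun γ j => ?_⟩
  · refine Eq.mpr (congrArg (Consistent Φ) (upto_Iic g β)) ?_
    exact ((hg β).2.2 (key β).1 (key β).2).2.1
  · obtain ⟨β, h, e⟩ := htask (γ, j) γ
    refine ⟨β, h.le, ?_⟩
    have := ((hg β).2.2 (key β).1 (key β).2).2.2
    rw [e] at this
    have := this h
    rwa [← upto_Iic] at this

end Cond

end TA

/-! ### Consistency at limit stages. -/

namespace TA

open Cardinal

/-- Compactness is applied to sentences saying that a sort is inhabited. These need a quantified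
body, and the fragment may offer no tautology. -/
theorem Fragment.exists_model_nonempty {𝓛 : Fragment.{u}} (hcomp : 𝓛.Compact)
    (hneg : 𝓛.hasNeg) (hex : 𝓛.hasEx) {Sg : Signature.{u}} (hSg : Sg ∈ 𝓛.sig)
    {φ : Sg.Sentence} (hφ : φ ∈ 𝓛.sen Sg) {Ψ : Set Sg.Sentence} (hΨ : Ψ ⊆ 𝓛.sen Sg)
    (J : Set Sg.Srt)
    (hfin : ∀ J₀ ⊆ J, J₀.Finite → ∃ M : Model Sg.Srt Sg.Lab Sg.Op,
      Models M Ψ ∧ ∀ s ∈ J₀, Nonempty (M.carrier s)) :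
    ∃ M : Model Sg.Srt Sg.Lab Sg.Op, Models M Ψ ∧ ∀ s ∈ J, Nonempty (M.carrier s) := by
  classical
  -- Either `φ` or its negation can serve as the body: if both failed, on finite sets `J₁` and `J₂`,
  -- a model for the union of these sets would satisfy neither.
  obtain ⟨χ, hχ, hfin'⟩ : ∃ χ ∈ 𝓛.sen Sg, ∀ J₀ ⊆ J, J₀.Finite →
      ∃ M : Model Sg.Srt Sg.Lab Sg.Op,
        Models M Ψ ∧ Sat M χ ∧ ∀ s ∈ J₀, Nonempty (M.carrier s) := by
    by_contra hcon
    push Not at hcon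
    obtain ⟨J₁, h₁, f₁, H₁⟩ := hcon φ hφ
    obtain ⟨J₂, h₂, f₂, H₂⟩ := hcon (.neg φ) ⟨hneg, hφ⟩
    obtain ⟨M, hM, hM'⟩ := hfin (J₁ ∪ J₂) (Set.union_subset h₁ h₂) (f₁.union f₂)
    by_cases h : Sat M φ
    · obtain ⟨s, hs, he⟩ := H₁ M hM h
      exact (not_isEmpty_iff.2 (hM' s (.inl hs))) he
    · obtain ⟨s, hs, he⟩ := H₂ M hM h
      exact (not_isEmpty_iff.2 (hM' s (.inr hs))) he
  let f : Sg.Srt → Sg.Sentence := fun s => .ex (Block.single s) (χ.map (incl Sg.Op _))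
  have hf : ∀ (M : Model Sg.Srt Sg.Lab Sg.Op) (s : Sg.Srt),
      Sat M (f s) ↔ Nonempty (M.carrier s) ∧ Sat M χ := by
    intro M s
    constructor
    · rintro ⟨v, hv⟩
      exact ⟨⟨v s (Block.singleVar s)⟩, (sat_map _ _ _).1 hv⟩
    · rintro ⟨⟨a⟩, h⟩
      have hv : ∀ s', (Block.single s).fam s' → M.carrier s' := fun s' x =>
        have e : s' = s := congrArg Prod.snd (Finset.mem_singleton.1 x.down.2)
        e ▸ a
      exact ⟨hv, (sat_map _ _ _).2 h⟩
  obtain ⟨M, hM⟩ := (hcomp Sg hSg (Ψ ∪ f '' J) (by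
    rintro ψ (hψ | ⟨s, -, rfl⟩)
    · exact hΨ hψ
    · exact ⟨hex, (𝓛.isSen_map _ _).2 hχ⟩)).2 (by
    intro Ψ' hsub hΨ'
    have h1 : ((hΨ'.sdiff (t := Ψ)).toFinset : Set Sg.Sentence) ⊆ f '' J := by
      intro ψ hψ
      rw [Set.Finite.coe_toFinset] at hψ
      exact (hsub hψ.1).resolve_left hψ.2
    obtain ⟨J₀, hJ₀, e⟩ := Finset.subset_set_image_iff.1 h1
    obtain ⟨M, hM, hMχ, hne⟩ := hfin' J₀ hJ₀ J₀.finite_toSet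
    refine ⟨M, fun ψ hψ => ?_⟩
    by_cases h : ψ ∈ Ψ
    · exact hM ψ h
    · have : ψ ∈ J₀.image f := by
        rw [e, Set.Finite.mem_toFinset]
        exact ⟨hψ, h⟩
      obtain ⟨s, hs, rfl⟩ := Finset.mem_image.1 this
      exact (hf M s).2 ⟨hne s hs, hMχ⟩)
  exact ⟨M, fun ψ hψ => hM ψ (.inl hψ), fun s hs =>
    ((hf M s).1 (hM (f s) (.inr ⟨s, hs, rfl⟩))).1⟩

namespace Cond

variable {S L : Type u} {F : Ops S} {C : S → Type u}

/-- The facts of a condition as sentences over its own constants. -/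
def sentences (p : Cond L F C) : Set (Sen S L (Ext F (fam p.consts))) :=
  {ψ | ∃ x ∈ p.facts, ∃ h : x.1 ⊆ p.consts, ψ = x.2.map (famIncl F h)}

/-- The theory whose models are the models of a condition. -/
def theory (Φ : Set (Sen S L F)) (p : Cond L F C) : Set (Sen S L (Ext F (fam p.consts))) :=
  Sen.map (incl F (fam p.consts)) '' Φ ∪ p.sentences

theorem models_theory {Φ : Set (Sen S L F)} {p : Cond L F C} {A : Model S L F}
    {v : ∀ s, fam p.consts s → A.carrier s} :
    Models (A.expand v) (p.theory Φ) ↔ p.Holds Φ A v := by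
  constructor
  · intro h
    refine ⟨fun φ hφ => (sat_map _ _ _).1 (h _ (.inl ⟨φ, hφ, rfl⟩)), fun x hx hs => ?_⟩
    exact (sat_map_famIncl hs A v x.2).1 (h _ (.inr ⟨x, hx, hs, rfl⟩))
  · rintro ⟨h1, h2⟩ ψ (⟨φ, hφ, rfl⟩ | ⟨x, hx, hs, rfl⟩)
    · exact (sat_map _ _ _).2 (h1 φ hφ)
    · exact (sat_map_famIncl hs A v x.2).2 (h2 x hx hs)

theorem isSen_theory {𝓛 : Fragment.{u}} {Φ : Set (Sen S L F)} (hΦ : ∀ φ ∈ Φ, 𝓛.IsSen φ)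
    {p : Cond L F C} (hp : ∀ x ∈ p.facts, 𝓛.IsSen x.2) :
    ∀ ψ ∈ p.theory Φ, 𝓛.IsSen ψ := by
  rintro _ (⟨φ, hφ, rfl⟩ | ⟨x, hx, hs, rfl⟩)
  · exact (𝓛.isSen_map _ _).2 (hΦ φ hφ)
  · exact (𝓛.isSen_map _ _).2 (hp x hx)

theorem satisfiable_theory {Φ : Set (Sen S L F)} {p : Cond L F C} :
    Satisfiable (p.theory Φ) ↔ p.Consistent Φ := by
  constructor
  · rintro ⟨M, hM⟩
    obtain ⟨A, v, rfl⟩ := M.exists_eq_expand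
    exact ⟨A, v, models_theory.1 hM⟩
  · rintro ⟨A, v, h⟩
    exact ⟨A.expand v, models_theory.2 h⟩

/-- Finitely many properties which hold eventually hold at once. -/
theorem exists_of_finite {I : Type u} [LinearOrder I] [Nonempty I] {Z : Type v} {A : Set Z}
    (hA : A.Finite) (R : Z → I → Prop) (hR : ∀ z γ δ, γ ≤ δ → R z γ → R z δ)
    (h : ∀ z ∈ A, ∃ γ, R z γ) (γ₀ : I) : ∃ γ, γ₀ ≤ γ ∧ ∀ z ∈ A, R z γ := by
  have := hA.to_subtype
  choose f hf using fun z : A => h z z.2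
  obtain ⟨M, hM⟩ := Finite.exists_le f
  exact ⟨max γ₀ M, le_max_left _ _, fun z hz =>
    hR z _ _ ((hM ⟨z, hz⟩).trans (le_max_right _ _)) (hf ⟨z, hz⟩)⟩

/-- A finite part of the limit theory involves facts of a single stage only, but a model of that
stage must also interpret the constants added later, so their sorts must be inhabited. -/
theorem consistent_iSup_of_compact {Sg : Signature.{u}} {C : Sg.Srt → Type u} {𝓛 : Fragment.{u}}
    {α : Cardinal.{u}} (hcomp : 𝓛.Compact) (hneg : 𝓛.hasNeg) (hSg : Sg ∈ 𝓛.sig)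
    (hne : (𝓛.sen Sg).Nonempty) {Φ : Set Sg.Sentence} (hΦ : Φ ⊆ 𝓛.sen Sg)
    (hC : ∀ s, Nonempty (C s) → 𝓛.NeedsConst Sg.Lab Sg.Op s)
    {I : Type u} [LinearOrder I] [Nonempty I] (q : I → Cond Sg.Lab Sg.Op C)
    (hmono : ∀ γ δ, γ ≤ δ → q γ ≤ q δ) (hadm : ∀ γ, (q γ).Admissible 𝓛 α)
    (hcons : ∀ γ, (q γ).Consistent Φ) : (iSup q).Consistent Φ := by
  classical
  have hle : ∀ γ, q γ ≤ iSup q := fun γ =>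
    ⟨Set.subset_iUnion (fun γ => (q γ).consts) γ, Set.subset_iUnion (fun γ => (q γ).facts) γ⟩
  have hmodel : ∀ γ, ∃ (A : Model Sg.Srt Sg.Lab Sg.Op) (v : ∀ s, fam (q γ).consts s → A.carrier s),
      (q γ).Holds Φ A v ∧ ∀ s, fam (iSup q).consts s → Nonempty (A.carrier s) := by
    intro γ
    by_cases hex : 𝓛.hasEx
    · obtain ⟨φ, hφ⟩ := hne
      obtain ⟨M, hM, hM'⟩ := Fragment.exists_model_nonempty hcomp hneg hex
        (𝓛.extend_mem Sg hSg (fam (q γ).consts)) (φ := φ.map (incl Sg.Op _))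
        ((𝓛.isSen_map _ _).2 hφ) (Ψ := (q γ).theory Φ)
        (isSen_theory hΦ (hadm γ).isSen) {s | Nonempty (fam (iSup q).consts s)} (by
          intro J₀ hJ₀ hfin
          obtain ⟨δ, hδ, h⟩ := exists_of_finite hfin
            (fun s δ => Nonempty (fam (q δ).consts s))
            (fun s δ ε h ⟨c⟩ => ⟨⟨c.1, (hmono _ _ h).1 c.2⟩⟩)
            (fun s hs => by
              obtain ⟨⟨c, hc⟩⟩ := hJ₀ hs
              obtain ⟨δ, hδ⟩ := Set.mem_iUnion.1 hc
              exact ⟨δ, ⟨⟨c, hδ⟩⟩⟩) γ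
          obtain ⟨A, v, hv⟩ := hcons δ
          exact ⟨A.expand (res (hmono _ _ hδ).1 v),
            models_theory.2 (hv.mono (hmono _ _ hδ)), fun s hs => ⟨v s (h s hs).some⟩⟩)
      obtain ⟨A, v, rfl⟩ := Model.exists_eq_expand M
      exact ⟨A, v, models_theory.1 hM, fun s c => hM' s ⟨c⟩⟩
    · obtain ⟨A, v, hv⟩ := hcons γ
      refine ⟨A, v, hv, fun s c => ?_⟩
      -- Without quantifiers, a sort with new constants has a ground term, whose value inhabits the
      -- carrier.
      exact ⟨A.eval ((hC s ⟨c.1⟩).resolve_left hex).2.2.some⟩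
  rw [← satisfiable_theory]
  refine (hcomp _ (𝓛.extend_mem Sg hSg (fam (iSup q).consts)) ((iSup q).theory Φ) ?_).2 ?_
  · refine isSen_theory hΦ fun x hx => ?_
    obtain ⟨γ, hγ⟩ := Set.mem_iUnion.1 hx
    exact (hadm γ).isSen x hγ
  · intro Ψ hΨ hfin
    obtain ⟨γ, -, h⟩ := exists_of_finite hfin
      (fun ψ γ => ψ ∈ Sen.map (incl Sg.Op (fam (iSup q).consts)) '' Φ ∨
        ∃ x ∈ (q γ).facts, ∃ h : x.1 ⊆ (iSup q).consts, ψ = x.2.map (famIncl Sg.Op h))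
      (fun ψ γ δ h hψ => hψ.imp_right fun ⟨x, hx, hx'⟩ => ⟨x, (hmono _ _ h).2 hx, hx'⟩)
      (fun ψ hψ => by
        rcases hΨ hψ with hψ | ⟨x, hx, hx'⟩
        · exact ⟨Classical.arbitrary I, .inl hψ⟩
        · obtain ⟨γ, hγ⟩ := Set.mem_iUnion.1 hx
          exact ⟨γ, .inr ⟨x, hγ, hx'⟩⟩) (Classical.arbitrary I)
    obtain ⟨A, v, hv, hA⟩ := hmodel γ
    -- Constants that are not yet present at stage γ receive arbitrary values; the facts of that
    -- stage do not mention them.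
    let v' : ∀ s, fam (iSup q).consts s → A.carrier s := fun s c =>
      if h : (⟨s, c.1⟩ : Σ s, C s) ∈ (q γ).consts then v s ⟨c.1, h⟩ else (hA s c).some
    have hv' : res (hle γ).1 v' = v := by
      funext s c
      exact dif_pos c.2
    refine ⟨A.expand v', fun ψ hψ => ?_⟩
    rcases h ψ hψ with ⟨φ, hφ, rfl⟩ | ⟨x, hx, hs, rfl⟩
    · exact (sat_map _ _ _).2 (hv.1 φ hφ)
    · refine (sat_map_famIncl hs A v' x.2).2 ?_
      have := hv.2 x hx ((hadm γ).sub x hx)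
      rw [← hv'] at this
      exact this

theorem consistent_iSup_Iio {Sg : Signature.{u}} {C : Sg.Srt → Type u} {𝓛 : Fragment.{u}}
    {α : Cardinal.{u}} (hα : ℵ₀ ≤ α) (hcomp : ℵ₀ < α → 𝓛.Compact) (hneg : 𝓛.hasNeg)
    (hSg : Sg ∈ 𝓛.sig)
    (hne : (𝓛.sen Sg).Nonempty) {Φ : Set Sg.Sentence} (hΦ : Φ ⊆ 𝓛.sen Sg)
    (hsat : Satisfiable Φ)
    (hC : ∀ s, Nonempty (C s) → 𝓛.NeedsConst Sg.Lab Sg.Op s)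
    (β : α.ord.ToType) (q : α.ord.ToType → Cond Sg.Lab Sg.Op C)
    (hmono : ∀ γ δ, γ ≤ δ → q γ ≤ q δ)
    (hq : ∀ γ < β, (q γ).Admissible 𝓛 α ∧ (q γ).Consistent Φ) :
    (iSup fun δ : Set.Iio β => q δ).Consistent Φ := by
  rcases isEmpty_or_nonempty (Set.Iio β) with hE | hE
  · obtain ⟨A, hA⟩ := hsat
    have hD : ∀ x, x ∉ (iSup fun δ : Set.Iio β => q δ).consts := fun x hx =>
      hE.false (Set.mem_iUnion.1 hx).choose
    exact ⟨A, fun s c => absurd c.2 (hD _), hA, fun x hx =>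
      hE.elim (Set.mem_iUnion.1 hx).choose⟩
  by_cases hmax : ∃ γ : Set.Iio β, ∀ δ : Set.Iio β, δ ≤ γ
  · obtain ⟨γ, hγ⟩ := hmax
    have e : (iSup fun δ : Set.Iio β => q δ) = q γ := by
      refine Cond.ext ?_ ?_
      · exact Set.Subset.antisymm (Set.iUnion_subset fun δ => (hmono _ _ (hγ δ)).1)
          (Set.subset_iUnion (fun δ : Set.Iio β => (q δ).consts) γ)
      · exact Set.Subset.antisymm (Set.iUnion_subset fun δ => (hmono _ _ (hγ δ)).2)
          (Set.subset_iUnion (fun δ : Set.Iio β => (q δ).facts) γ)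
    rw [e]
    exact (hq γ γ.2).2
  -- A nonempty initial segment without a maximum is infinite, which cannot happen below ω; this is
  -- where compactness enters.
  · have hlt : ℵ₀ < α := by
      refine lt_of_le_of_ne hα fun h => hmax ?_
      have : Finite (Set.Iio β) := by
        rw [← lt_aleph0_iff_finite, h]
        simpa using mk_Iio_lt β
      obtain ⟨γ, hγ⟩ := Finite.exists_max (id : Set.Iio β → Set.Iio β)
      exact ⟨γ, hγ⟩
    exact consistent_iSup_of_compact (hcomp hlt) hneg hSg hne hΦ hC (fun δ : Set.Iio β => q δ)
      (fun γ δ h => hmono _ _ h) (fun γ => (hq γ γ.2).1) (fun γ => (hq γ γ.2).2)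

end Cond

end TA

/-! ### Refuting types and assembling the model. -/

namespace TA

open Cardinal

theorem reduct_substitution {S L : Type u} {F : Ops S} {X D : S → Type u} (A : Model S L F)
    (v : ∀ s, D s → A.carrier s) (θ : ∀ s, X s → Term (Ext F D) s) :
    (A.expand v).reduct (substitution θ) = A.expand fun s x => (A.expand v).eval (θ s x) := by
  refine Model.ext_op (fun w s f => ?_)
  cases f <;> rfl

theorem sat_map_substitution {S L : Type u} {F : Ops S} {X D : S → Type u} (A : Model S L F)
    (v : ∀ s, D s → A.carrier s) (θ : ∀ s, X s → Term (Ext F D) s) (φ : Sen S L (Ext F X)) :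
    Sat (A.expand v) (φ.map (substitution θ)) ↔
      Sat (A.expand fun s x => (A.expand v).eval (θ s x)) φ := by
  rw [sat_map, reduct_substitution]

/-- An unbounded family would give cof α ≤ #I, and then α < α ^ cof α ≤ α ^ #I ≤ α by König's
theorem. -/
theorem exists_bound_of_power_le {α : Cardinal.{u}} (hα : ℵ₀ ≤ α) {I : Type u}
    (hI : α ^ #I ≤ α) (f : I → α.ord.ToType) : ∃ β, ∀ i, f i ≤ β := by
  by_contra hcon
  push Not at hcon
  have hcof : IsCofinal (Set.range f) := fun β => by
    obtain ⟨i, hi⟩ := hcon β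
    exact ⟨f i, ⟨i, rfl⟩, hi.le⟩
  have h1 : α.ord.cof ≤ #I := by
    rw [← Ordinal.cof_toType]
    exact (Order.cof_le hcof).trans mk_range_le
  exact absurd ((lt_power_cof_ord hα).trans_le
    (power_le_power_left (aleph0_pos.trans_le hα).ne' h1)) (not_lt.2 hI)

theorem exists_surjective_of_mk_le {α : Cardinal.{u}} {Z : Type v} [Nonempty Z]
    (h : lift.{u} #Z ≤ lift.{v} α) : ∃ e : α.ord.ToType → Z, Function.Surjective e := by
  rw [← mk_ord_toType α] at h
  obtain ⟨f⟩ := lift_mk_le'.1 h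
  exact ⟨Function.invFun f, Function.invFun_surjective f.injective⟩

namespace Fragment

variable {𝓛 : Fragment.{u}} {α : Cardinal.{u}}

/-- If atoms exist, terms number at most α and the cardinal condition on types bounds the
substitutions. If not, terms may be too many, but all substitutions act alike on sentences. The
value `none` covers the case that no substitution exists. -/
theorem exists_substitution_list {S L : Type u} {F : Ops S} (hα : ℵ₀ ≤ α) {X D : S → Type u}
    (hX : α ^ #(Σ s, X s) ≤ α) (hD : 𝓛.AtomFormer L → #(Σ s, Term (Ext F D) s) ≤ α)
    {T : Set (Sen S L (Ext F X))} (hT : ∀ φ ∈ T, 𝓛.IsSen φ) :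
    ∃ e : α.ord.ToType → Option (∀ s, X s → Term (Ext F D) s), ∀ θ, ∃ k θ', e k = some θ' ∧
      ∀ φ ∈ T, φ.map (substitution θ) = φ.map (substitution θ') := by
  have hne : Nonempty α.ord.ToType := by
    rw [← mk_ne_zero_iff, mk_ord_toType]
    exact (aleph0_pos.trans_le hα).ne'
  rcases isEmpty_or_nonempty (∀ s, X s → Term (Ext F D) s) with hE | hE
  · exact ⟨fun _ => none, fun θ => (hE.false θ).elim⟩
  by_cases hat : 𝓛.AtomFormer L
  · have hle : #(∀ s, X s → Term (Ext F D) s) ≤ α := by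
      refine (mk_le_of_injective
        (f := fun θ : ∀ s, X s → Term (Ext F D) s => fun x : Σ s, X s =>
          (⟨x.1, θ x.1 x.2⟩ : Σ s, Term (Ext F D) s)) ?_).trans ?_
      · intro θ θ' h
        funext s x
        have := congrFun h ⟨s, x⟩
        simpa using this
      · rw [mk_arrow, lift_id, lift_id]
        exact (power_le_power_right (hD hat)).trans hX
    obtain ⟨e, he⟩ := exists_surjective_of_mk_le (lift_le.2 hle)
    refine ⟨fun k => some (e k), fun θ => ?_⟩
    obtain ⟨k, rfl⟩ := he θ
    exact ⟨k, _, rfl, fun _ _ => rfl⟩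
  · exact ⟨fun _ => some hE.some, fun θ => ⟨hne.some, _, rfl,
      fun φ hφ => map_eq_of_not_atomFormer hat _ _ φ (hT φ hφ)⟩⟩

/-- The constants and sentences of the condition are candidates for `D` and Γ in the definition of
isolation. As they do not isolate the type, a model of the condition refutes an instance, whose
negation is recorded. -/
theorem exists_finExt_refuting {Sg : Signature.{u}} {C : Sg.Srt → Type u} (hα : ℵ₀ ≤ α)
    (hneg : 𝓛.hasNeg) {Φ : Set Sg.Sentence} {X : Sg.Srt → Type u}
    {T : Set (Sg.extend X).Sentence} (hT : T ⊆ 𝓛.sen (Sg.extend X))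
    (hloc : 𝓛.LocallyOmits Sg α Φ X T) {p : Cond Sg.Lab Sg.Op C} (hp : p.Admissible 𝓛 α)
    (hcons : p.Consistent Φ) {D : Set (Σ s, C s)} (hD : D ⊆ p.consts)
    (θ : ∀ s, X s → Term (Ext Sg.Op (fam D)) s) :
    ∃ q : Cond Sg.Lab Sg.Op C, p.FinExt q ∧ q.Admissible 𝓛 α ∧ q.Consistent Φ ∧
      ∃ h : D ⊆ q.consts, ∃ φ ∈ T, ∀ (A : Model Sg.Srt Sg.Lab Sg.Op)
        (v : ∀ s, fam q.consts s → A.carrier s), q.Holds Φ A v →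
        ¬ Sat (A.expand (res h v)) (Sen.map (substitution θ) φ) := by
  let θ' : ∀ s, X s → Term (Ext Sg.Op (fam p.consts)) s := fun s x => (θ s x).map (famIncl _ hD)
  have hnot : ¬ Entails (p.theory Φ) (Sen.map (substitution θ') '' T) := by
    intro hent
    refine hloc ⟨fam p.consts, ?_, p.sentences, ?_, ?_, Cond.satisfiable_theory.2 hcons, θ', hent⟩
    · refine lt_of_le_of_lt (mk_le_of_injective
        (f := fun x : Σ s, fam p.consts s => (⟨⟨x.1, x.2.1⟩, x.2.2⟩ : p.consts)) ?_) hp.consts_lt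
      rintro ⟨s, c, hc⟩ ⟨s', c', hc'⟩ h
      simp only [Subtype.mk.injEq, Sigma.mk.injEq] at h
      obtain ⟨rfl, h⟩ := h
      cases h
      rfl
    · rintro _ ⟨x, hx, hs, rfl⟩
      exact (𝓛.isSen_map _ _).2 (hp.isSen x hx)
    · refine lt_of_le_of_lt ?_ hp.facts_lt
      refine mk_le_of_surjective (f := fun x : p.facts =>
        (⟨x.1.2.map (famIncl _ (hp.sub x.1 x.2)), x.1, x.2, hp.sub x.1 x.2, rfl⟩ : p.sentences)) ?_
      rintro ⟨_, x, hx, hs, rfl⟩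
      exact ⟨⟨x, hx⟩, rfl⟩
  have : ∃ M, Models M (p.theory Φ) ∧ ∃ φ ∈ T, ¬ Sat M (Sen.map (substitution θ') φ) := by
    by_contra hcon
    push Not at hcon
    refine hnot fun M hM => ?_
    rintro _ ⟨φ, hφ, rfl⟩
    exact hcon M hM φ hφ
  obtain ⟨M, hM, φ, hφ, hMφ⟩ := this
  obtain ⟨A, v, rfl⟩ := Model.exists_eq_expand M
  have hv := Cond.models_theory.1 hM
  have hrefute : ¬ Sat (A.expand (res hD v)) (Sen.map (substitution θ) φ) := by
    intro h
    refine hMφ ?_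
    have e : (fun s x => (A.expand v).eval (θ' s x)) =
        fun s x => (A.expand (res hD v)).eval (θ s x) := by
      funext s x
      exact eval_map_famIncl hD A v (θ s x)
    exact (sat_map_substitution A v θ' φ).2
      ((congrArg (fun b : ∀ s, X s → A.carrier s => Sat (A.expand b) φ) e).mpr
        ((sat_map_substitution A (res hD v) θ φ).1 h))
  obtain ⟨q, hqc, hq, hmem⟩ := Cond.exists_next_fact hα hp hv hD
    (.neg (Sen.map (substitution θ) φ)) ⟨hneg, (𝓛.isSen_map _ _).2 (hT hφ)⟩ hrefute
  exact ⟨q, hq.ext, hq.adm, ⟨A, _, hq.holds⟩, hD.trans hq.ext.1.1, φ, hφ,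
    fun B z hz => hz.2 _ hmem _⟩

/-- A realization would be named by a substitution at one stage. By the truth lemma each instance of
the type would then be forced, while a later stage refutes one of them. -/
theorem _root_.TA.Generic.not_realizes {Sg : Signature.{u}} {C : Sg.Srt → Type u}
    {Φ : Set Sg.Sentence} {K : Type u} [LinearOrder K] [Nonempty K]
    {p : K → Cond Sg.Lab Sg.Op C} (g : Generic 𝓛 Φ p) {X : Sg.Srt → Type u}
    {T : Set (Sg.extend X).Sentence} (hT : T ⊆ 𝓛.sen (Sg.extend X))
    (hX : ∀ f : (Σ s, X s) → K, ∃ β, ∀ i, f i ≤ β)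
    (hrefute : ∀ γ (θ : ∀ s, X s → Term (Ext Sg.Op (fam (p γ).consts)) s),
      ∃ β, γ ≤ β ∧ ∃ h : (p γ).consts ⊆ (p β).consts, ∃ φ ∈ T,
        ∀ (A : Model Sg.Srt Sg.Lab Sg.Op) (v : ∀ s, fam (p β).consts s → A.carrier s),
        (p β).Holds Φ A v → ¬ Sat (A.expand (res h v)) (Sen.map (substitution θ) φ)) :
    ¬ Realizes g.model T := by
  rintro ⟨b, hb⟩
  obtain ⟨γ, -, ts, hts⟩ := g.exists_reps hX (Classical.arbitrary K) (fun x => x.1)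
    (fun x => b x.1 x.2)
  obtain ⟨β, k, h, φ, hφ, H⟩ := hrefute γ fun s x => ts ⟨s, x⟩
  have e := reduct_substitution g.model (g.val γ) fun s x => ts ⟨s, x⟩
  have e' : (fun s x => (g.model.expand (g.val γ)).eval (ts ⟨s, x⟩)) = b := by
    funext s x
    rw [g.eval_model]
    exact hts ⟨s, x⟩
  have hs : Sat ((g.model.expand (g.val γ)).reduct (substitution fun s x => ts ⟨s, x⟩)) φ := by
    rw [e]
    exact (congrArg (fun b : ∀ s, X s → g.model.carrier s => Sat (g.model.expand b) φ) e').mpr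
      (hb φ hφ)
  obtain ⟨δ, l, H'⟩ := (g.sat_model φ (hT hφ) γ _).1 hs
  obtain ⟨A, v, hv⟩ := g.consistent (max β δ)
  exact H A _ (hv.mono (g.mono (le_max_left _ _)))
    ((sat_map _ _ _).2 (H' A _ (hv.mono (g.mono (le_max_right _ _)))))

theorem otp_of_compact (hneg : 𝓛.hasNeg) (hα : ℵ₀ ≤ α) (hcomp : ℵ₀ < α → 𝓛.Compact) :
    𝓛.OTP α := by
  intro Sg hSg hpow Φ hΦ hsat ι hι X T hT hloc
  have hpow' : #{φ : Sen Sg.Srt Sg.Lab Sg.Op | 𝓛.IsSen φ} ≤ lift.{u + 1} α := hpow.le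
  have hne : (𝓛.sen Sg).Nonempty := by
    rw [Set.nonempty_iff_ne_empty]
    intro h
    unfold HasPower at hpow
    rw [h, mk_eq_zero] at hpow
    exact (aleph0_pos.trans_le (aleph0_le_lift.2 hα)).ne hpow
  have hK : Nonempty α.ord.ToType := by
    rw [← mk_ne_zero_iff, mk_ord_toType]
    exact (aleph0_pos.trans_le hα).ne'
  -- α constants for each sort that may need witnesses and none elsewhere, so that there are at most
  -- α in total even if the signature has more sorts.
  let C : Sg.Srt → Type u := fun s => {_k : α.ord.ToType // 𝓛.NeedsConst Sg.Lab Sg.Op s}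
  have hCn : ∀ s, Nonempty (C s) → 𝓛.NeedsConst Sg.Lab Sg.Op s := fun s ⟨c⟩ => c.2
  have hfresh : ∀ s, 𝓛.NeedsConst Sg.Lab Sg.Op s → α ≤ #(C s) := fun s hs => by
    rw [← mk_ord_toType α]
    exact mk_le_of_injective (f := fun k => (⟨k, hs⟩ : C s)) fun a b h => congrArg Subtype.val h
  have hC : #(Σ s, C s) ≤ α := by
    refine (mk_le_of_injective (f := fun x : Σ s, C s =>
      ((⟨x.1, x.2.2⟩ : {s // 𝓛.NeedsConst Sg.Lab Sg.Op s}), x.2.1)) ?_).trans ?_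
    · rintro ⟨s, c⟩ ⟨s', c'⟩ h
      simp only [Prod.mk.injEq, Subtype.mk.injEq] at h
      obtain ⟨rfl, h⟩ := h
      rw [Subtype.ext h]
    · simp only [mk_prod, lift_id, mk_ord_toType]
      exact mul_le_of_le hα (mk_needsConst_le hpow' hne) le_rfl
  have hfam : ∀ D : Set (Σ s, C s), #(Σ s, fam D s) ≤ α := fun D =>
    (mk_le_of_injective (f := fun x : Σ s, fam D s => (⟨x.1, x.2.1⟩ : Σ s, C s)) (by
      rintro ⟨s, c, hc⟩ ⟨s', c', hc'⟩ h
      simp only [Sigma.mk.injEq] at h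
      obtain ⟨rfl, h⟩ := h
      cases h
      rfl)).trans hC
  have hfamn : ∀ (D : Set (Σ s, C s)) s, Nonempty (fam D s) → 𝓛.NeedsConst Sg.Lab Sg.Op s :=
    fun D s ⟨c⟩ => c.1.2
  have henum : ∀ D : Set (Σ s, C s), ∃ e : α.ord.ToType →
      {φ : Sen Sg.Srt Sg.Lab (Ext Sg.Op (fam D)) // 𝓛.IsSen φ}, Function.Surjective e := by
    intro D
    obtain ⟨φ, hφ⟩ := hne
    have : Nonempty {φ : Sen Sg.Srt Sg.Lab (Ext Sg.Op (fam D)) // 𝓛.IsSen φ} :=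
      ⟨⟨φ.map (incl _ _), (𝓛.isSen_map _ _).2 hφ⟩⟩
    refine exists_surjective_of_mk_le ?_
    rw [lift_id'.{u, u + 1}]
    exact mk_sen_ext_le hα hpow' ⟨φ, hφ⟩ (hfam D) (hfamn D)
  choose es hes using henum
  have htypes := fun (D : Set (Σ s, C s)) (i : ι) =>
    exists_substitution_list (L := Sg.Lab) (F := Sg.Op) (D := fam D) hα (hT i).1
      (mk_term_ext_le hα hpow' (hfam D) (hfamn D)) (hT i).2
  choose et het using htypes
  -- Tasks are indices into enumerations that depend on the constants of a stage: the left summand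
  -- settles a sentence, the right one refutes a type under a listed substitution.
  let goal : Set (Σ s, C s) → α.ord.ToType ⊕ (ι × α.ord.ToType) → Cond Sg.Lab Sg.Op C → Prop :=
    fun D j q => match j with
    | .inl k => q.Settles Φ (es D k).1
    | .inr (i, k) => ∀ θ, et D i k = some θ → ∃ h : D ⊆ q.consts, ∃ φ ∈ T i,
        ∀ (A : Model Sg.Srt Sg.Lab Sg.Op) (v : ∀ s, fam q.consts s → A.carrier s),
        q.Holds Φ A v → ¬ Sat (A.expand (res h v)) (Sen.map (substitution θ) φ)
  have hJ : #(α.ord.ToType ⊕ (ι × α.ord.ToType)) ≤ α := by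
    simp only [mk_sum, mk_prod, lift_id, mk_ord_toType]
    exact add_le_of_le hα le_rfl (mul_le_of_le hα hι le_rfl)
  obtain ⟨q, hmono, hcons, hgoal⟩ := Cond.exists_chain (𝓛 := 𝓛) (Φ := Φ) hα hJ goal (by
    rintro p hp hc D hD (k | ⟨i, k⟩)
    · exact Cond.exists_settles hα hfresh hCn hp hc hD (es D k).1 (es D k).2
    · cases h : et D i k with
      | none =>
        refine ⟨p, .refl p, hp, hc, fun θ hθ => ?_⟩
        rw [h] at hθ
        cases hθ
      | some θ =>
        obtain ⟨q, h1, h2, h3, h4⟩ :=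
          exists_finExt_refuting hα hneg (hT i).2 (hloc i) hp hc hD θ
        refine ⟨q, h1, h2, h3, fun θ' hθ' => ?_⟩
        rw [h] at hθ'
        cases hθ'
        exact h4)
    (Cond.consistent_iSup_Iio hα hcomp hneg hSg hne hΦ hsat hCn)
  have g : Generic 𝓛 Φ q := by
    refine ⟨fun h => hmono _ _ h, hcons, fun γ ψ hψ => ?_⟩
    obtain ⟨k, hk⟩ := hes (q γ).consts ⟨ψ, hψ⟩
    obtain ⟨β, h, hs⟩ := hgoal γ (.inl k)
    refine ⟨β, h, ?_⟩
    simp only [goal] at hs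
    rw [hk] at hs
    exact hs
  refine ⟨g.model, fun φ hφ => ?_, fun i => ?_⟩
  · have γ : α.ord.ToType := hK.some
    exact (g.sat_model φ (hΦ hφ) γ (incl _ _)).2 ⟨γ, le_rfl, fun A v hv => hv.1 φ hφ⟩
  · refine g.not_realizes (hT i).2 (exists_bound_of_power_le hα (hT i).1) fun γ θ => ?_
    obtain ⟨k, θ', hk, hθ⟩ := het (q γ).consts i θ
    obtain ⟨β, h, H⟩ := hgoal γ (.inr (i, k))
    obtain ⟨hs, φ, hφ, H⟩ := H θ' hk
    refine ⟨β, h, hs, φ, hφ, ?_⟩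
    rw [hθ φ hφ]
    exact H

end Fragment

end TA

theorem theorem5 (𝓛 : TA.Fragment.{u}) (hneg : 𝓛.hasNeg) :
    (∀ α : Cardinal.{u}, Cardinal.aleph0 ≤ α → (Cardinal.aleph0 < α → 𝓛.Compact) → 𝓛.OTP α) ∧
      𝓛.OTP Cardinal.aleph0 :=
  ⟨fun _ hα hcomp => TA.Fragment.otp_of_compact hneg hα hcomp,
    TA.Fragment.otp_of_compact hneg le_rfl fun h => absurd h (lt_irrefl _)⟩
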